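/- Let $M$ be a connected smooth $n$-dimensional manifold, and let $\mathfrak X=(X_1,\dots,X_m)$ be smooth vector fields on $M$. Let $\Omega\subset M$ be open and connected with compact closure, and assume Hörmander's condition: at each point of $\Omega$ the $X_i$ and their iterated commutators span the tangent space. Write $\mathfrak Xf=(X_1f,\dots,X_mf)$ and let $\mathfrak X^*\mathfrak Xf$ denote the symmetrized matrix with entries $\frac12(X_iX_jf+X_jX_if)$. Let $$\mathcal Lf=-\operatorname{Tr}\big(A(\mathfrak Xf)\,\mathfrak X^*\mathfrak Xf\big)+H(\mathfrak Xf),$$ where $A:\mathbb R^m\to\mathbb R^{m\times m}$ and $H:\mathbb R^m\to\mathbb R$ are continuous, $A(\xi)$ is symmetric and positive semi-definite for every $\xi$, $\langle A(\xi)\xi,\xi\rangle>0$ for every $\xi\ne0$, and there is a function $\phi:(0,1]\to(0,1]$ such that for all $t\ge1$, all $\xi\in\mathbb R^m\setminus\{0\}$ and all symmetric $Y\in\mathbb R^{m\times m}$ $$-\operatorname{Tr}(A(t\xi)Y)\le\frac{-\operatorname{Tr}(A(\xi)Y)}{t\,\phi(1/t)},\qquad H(t\xi)\le\frac{1}{\phi(1/t)}H(\xi).$$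 We say that $\mathcal Lw\le0$ (resp. $\mathcal Lw\ge0$) in $\Omega$ in the viscosity sense if $\mathcal L\psi(x)\le0$ (resp. $\ge0$) for every $x\in\Omega$ and every $\psi\in C^2(\Omega)$ such that $d\psi(x)\neq0$ and $w-\psi$ attains its maximum (resp. minimum) over $\Omega$ at $x$. A function $w$ is semi-convex near a point $y\in\Omega$ if, in some smooth local coordinates around $y$, there is $\Lambda>0$ such that $w+\frac12\Lambda|x|^2$ is convex on a coordinate ball around $y$ contained in $\Omega$; it is semi-concave near $y$ if $-w$ is semi-convex near $y$ (these notions do not depend on the coordinates). Let $u,v\in C(\overline\Omega)$ satisfy $u\le v$ on $\partial\Omega$ and $\mathcal Lu\le0\le\mathcal Lv$ in $\Omega$ in the viscosity sense. Assume that $u$ is semi-convex and $v$ is semi-concave near each point of $$\operatorname{argmax}_\Omega(u-v)=\{y\in\Omega:\ u(y)-v(y)=\max_\Omega(u-v)\},$$ so that $u$ and $v$ are differentiable at these points. If $\mathfrak Xu(y)\neq0$ for every $y\in\operatorname{argmax}_\Omega(u-v)$, or $\mathfrak Xv(y)\ne0$ for every $y\in\operatorname{argmax}_\Omega(u-v)$,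 then $u\le v$ in $\Omega$. -/

import Mathlib

open Set
open scoped Manifold ContDiff

noncomputable section

namespace SubellipticComparison

variable {n m : ℕ} {M : Type*} [TopologicalSpace M] [ChartedSpace (EuclideanSpace ℝ (Fin n)) M]

/-- The derivative `V f` of a real function `f` along a vector field `V`. -/
def along (V : (x : M) → TangentSpace (𝓡 n) x) (f : M → ℝ) : M → ℝ :=
  fun x => mvfderiv (𝓡 n) f x (V x)

/-- The horizontal gradient `(X₁ f, …, X_m f)` at `x`. -/
def hgrad (X : Fin m → (x : M) → TangentSpace (𝓡 n) x) (f : M → ℝ) (x : M) : Fin m → ℝ :=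
  fun i => along (X i) f x

/-- The symmetrized horizontal Hessian, with entries `(X_i X_j f + X_j X_i f) / 2`.  In coordinates
with `X_j = σ^j · ∇` it is `σᵀ (D² f) σ + M(x, ∇ f)`, where `M(x, ζ)` has the entries
`(⟨Dσ^j σ^i, ζ⟩ + ⟨Dσ^i σ^j, ζ⟩) / 2`. -/
def hhess (X : Fin m → (x : M) → TangentSpace (𝓡 n) x) (f : M → ℝ) (x : M) :
    Matrix (Fin m) (Fin m) ℝ :=
  Matrix.of fun i j => (along (X i) (along (X j) f) x + along (X j) (along (X i) f) x) / 2

/-- The quasilinear operator `L f = - Tr (A(𝔛f) 𝔛*𝔛f) + H(𝔛f)` at `x`. -/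
def quasilinearOp (X : Fin m → (x : M) → TangentSpace (𝓡 n) x)
    (A : (Fin m → ℝ) → Matrix (Fin m) (Fin m) ℝ) (H : (Fin m → ℝ) → ℝ) (f : M → ℝ) (x : M) : ℝ :=
  -(A (hgrad X f x) * hhess X f x).trace + H (hgrad X f x)

/-- The structure conditions on the coefficients: continuity, `A ≥ 0` symmetric, ellipticity in the
direction of the gradient, and scaling. -/
structure StructureConditions (A : (Fin m → ℝ) → Matrix (Fin m) (Fin m) ℝ)
    (H : (Fin m → ℝ) → ℝ) : Prop where
  continuous_A : Continuous A
  continuous_H : Continuous H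
  posSemidef : ∀ ξ, (A ξ).PosSemidef
  elliptic : ∀ ξ, ξ ≠ 0 → 0 < (A ξ).mulVec ξ ⬝ᵥ ξ
  scaling : ∃ φ : ℝ → ℝ, (∀ s ∈ Ioc (0 : ℝ) 1, φ s ∈ Ioc (0 : ℝ) 1) ∧
    ∀ t : ℝ, 1 ≤ t → ∀ ξ : Fin m → ℝ, ξ ≠ 0 →
      (∀ Y : Matrix (Fin m) (Fin m) ℝ, Y.IsSymm →
        -(A (t • ξ) * Y).trace ≤ -(A ξ * Y).trace / (t * φ (1 / t))) ∧
      H (t • ξ) ≤ 1 / φ (1 / t) * H ξ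

/-- The iterated commutators `X_i`, `[X_i, X_j]`, `[X_i, [X_j, X_k]]`, … of the fields `X`. -/
inductive IsCommutator (X : Fin m → (x : M) → TangentSpace (𝓡 n) x) :
    ((x : M) → TangentSpace (𝓡 n) x) → Prop
  | field (i : Fin m) : IsCommutator X (X i)
  | bracket (i : Fin m) (Y : (x : M) → TangentSpace (𝓡 n) x) (hY : IsCommutator X Y) :
      IsCommutator X (VectorField.mlieBracket (𝓡 n) (X i) Y)

/-- Hörmander's condition on `Ω`: at each point of `Ω` the iterated commutators span the tangent
space (by finite dimension, finitely many of them do). -/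
def Hormander (X : Fin m → (x : M) → TangentSpace (𝓡 n) x) (Ω : Set M) : Prop :=
  ∀ x ∈ Ω, Submodule.span ℝ {w : TangentSpace (𝓡 n) x | ∃ Y, IsCommutator X Y ∧ w = Y x} = ⊤

/-- `L w ≤ 0` in `Ω` in the viscosity sense: `L ψ (x) ≤ 0` at each `x ∈ Ω`, for each `C²` function
`ψ` on `Ω` with nonzero differential at `x` for which `w - ψ` has a maximum over `Ω` at `x`. -/
def ViscositySub (X : Fin m → (x : M) → TangentSpace (𝓡 n) x)
    (A : (Fin m → ℝ) → Matrix (Fin m) (Fin m) ℝ) (H : (Fin m → ℝ) → ℝ)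
    (Ω : Set M) (w : M → ℝ) : Prop :=
  ∀ x ∈ Ω, ∀ ψ : M → ℝ, ContMDiffOn (𝓡 n) 𝓘(ℝ, ℝ) 2 ψ Ω →
    IsMaxOn (fun y => w y - ψ y) Ω x → mvfderiv (𝓡 n) ψ x ≠ 0 →
    quasilinearOp X A H ψ x ≤ 0

/-- `0 ≤ L w` in `Ω` in the viscosity sense. -/
def ViscositySuper (X : Fin m → (x : M) → TangentSpace (𝓡 n) x)
    (A : (Fin m → ℝ) → Matrix (Fin m) (Fin m) ℝ) (H : (Fin m → ℝ) → ℝ)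
    (Ω : Set M) (w : M → ℝ) : Prop :=
  ∀ x ∈ Ω, ∀ ψ : M → ℝ, ContMDiffOn (𝓡 n) 𝓘(ℝ, ℝ) 2 ψ Ω →
    IsMinOn (fun y => w y - ψ y) Ω x → mvfderiv (𝓡 n) ψ x ≠ 0 →
    0 ≤ quasilinearOp X A H ψ x

/-- The set of the points of `Ω` at which `f` attains its maximum over `Ω`. -/
def argmaxOn (Ω : Set M) (f : M → ℝ) : Set M :=
  {x | x ∈ Ω ∧ IsMaxOn f Ω x}

/-- `w` is semi-convex near `y`, in the coordinates `e`: on some coordinate ball around `y` inside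
`Ω`, the function `w + Λ |x|² / 2` is convex for some `Λ > 0`. -/
def SemiconvexNear (e : OpenPartialHomeomorph M (EuclideanSpace ℝ (Fin n))) (Ω : Set M)
    (w : M → ℝ) (y : M) : Prop :=
  ∃ r > 0, Metric.ball (e y) r ⊆ e.target ∩ e.symm ⁻¹' Ω ∧ ∃ Λ > 0,
    ConvexOn ℝ (Metric.ball (e y) r) (fun x => w (e.symm x) + 1 / 2 * Λ * ‖x‖ ^ 2)

/-- `w` is semi-concave near `y`, in the coordinates `e`. -/
def SemiconcaveNear (e : OpenPartialHomeomorph M (EuclideanSpace ℝ (Fin n))) (Ω : Set M)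
    (w : M → ℝ) (y : M) : Prop :=
  SemiconvexNear e Ω (fun x => -w x) y

end SubellipticComparison

end

/-! Suppose `u - v` is positive somewhere in `Ω`. Replace `v` by `F(v)`, where `F(s) = log (1 + ε (s
+ R)) / ε - R` is increasing and concave and tends to the identity as `ε → 0`. Its inverse `G` is
convex with `G' = t ≥ 1` on the range in question. A test function touching `F(v)` from below, with
horizontal gradient `ξ` and Hessian `Y`, gives after composition with `G` a test function for `v`
with gradient `t ξ` and Hessian `t (Y + ε ξ ⊗ ξ)`. The scaling condition divides out `t`, so `F(v)`
is a strict supersolution wherever `ξ ≠ 0`: the operator is at least `ε ⟨A(ξ) ξ, ξ⟩ > 0`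
(`StructureConditions.strict`, `ViscositySuper.le_jetOp`).

Maxima of `u - F(v)` over the closure of `Ω` accumulate, as `ε → 0`, at a maximum `x` of `u - v`,
which is interior by the boundary inequality. At `x` the functions `u` and `v` have a common
differential with nonzero horizontal part. Two-sided quadratic contact there keeps nearby
subgradients close to it, so the horizontal gradient is also nonzero at the approximating maxima.

At such a maximum the theorem on sums for semiconvex functions (`exists_superjets_closure`) gives a
common gradient `q` and Hessians with `S₁ ≤ -S₂` as quadratic forms. Degenerate ellipticity and
continuity of the operator then contradict the strict inequality.

The theorem on sums is proved through Moreau envelopes. For large `l` the envelope of a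
`Λ`-semiconvex function is `C^{1,1}`, with gradient `l (z - P z)` for a Lipschitz proximal map `P`.
Rademacher's theorem gives second derivatives almost everywhere, Jensen's lemma finds a near-maximum
at which both envelopes have them, and `local_upper_bound` carries the expansions back to the
functions. Throughout, `Λ`-semiconvexity is strong convexity with the negative modulus `-Λ`. -/

namespace SubellipticComparison

open scoped RealInnerProductSpace Topology

/-! ### Proximal points and Moreau envelopes of semiconvex functions -/

section Prox

variable {E : Type*} [NormedAddCommGroup E] [InnerProductSpace ℝ E]

/-- `y` minimizes `u + l / 2 * ‖· - z‖ ^ 2` over `K`. -/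
def IsProx (K : Set E) (u : E → ℝ) (l : ℝ) (z y : E) : Prop :=
  y ∈ K ∧ ∀ y' ∈ K, u y + l / 2 * ‖y - z‖ ^ 2 ≤ u y' + l / 2 * ‖y' - z‖ ^ 2

/-- `p` is a subgradient of the `Λ`-semiconvex function `u` at `y`, relative to `K`. -/
def SubgradAt (K : Set E) (Λ : ℝ) (u : E → ℝ) (y p : E) : Prop :=
  ∀ y' ∈ K, u y + ⟪p, y' - y⟫ - Λ / 2 * ‖y' - y‖ ^ 2 ≤ u y'

lemma SubgradAt.mono {K K' : Set E} {Λ : ℝ} {u : E → ℝ} {y p : E} (h : SubgradAt K Λ u y p)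
    (hK : K' ⊆ K) : SubgradAt K' Λ u y p := fun y' hy' => h y' (hK hy')

lemma norm_convexComb_sub_sq (y y' z : E) (t : ℝ) :
    ‖(1 - t) • y + t • y' - z‖ ^ 2
      = (1 - t) * ‖y - z‖ ^ 2 + t * ‖y' - z‖ ^ 2 - t * (1 - t) * ‖y - y'‖ ^ 2 := by
  have h1 : (1 - t) • y + t • y' - z = (1 - t) • (y - z) + t • (y' - z) := by module
  have h2 : y - y' = (y - z) - (y' - z) := by abel
  rw [h1, h2, norm_add_sq_real, norm_sub_sq_real (y - z) (y' - z), norm_smul, norm_smul, mul_pow, mul_pow,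
    inner_smul_left, inner_smul_right]
  simp only [Real.norm_eq_abs, sq_abs, conj_trivial]
  ring

lemma le_of_forall_one_sub_mul_le {c d : ℝ} (h : ∀ t ∈ Ioo (0 : ℝ) 1, (1 - t) * c ≤ d) :
    c ≤ d := by
  have h1 : Filter.Tendsto (fun t : ℝ => (1 - t) * c) (𝓝[>] 0) (𝓝 c) := by
    have : Filter.Tendsto (fun t : ℝ => (1 - t) * c) (𝓝 0) (𝓝 ((1 - 0) * c)) :=
      Continuous.tendsto (by fun_prop) 0
    simpa using this.mono_left nhdsWithin_le_nhds
  refine le_of_tendsto h1 ?_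
  filter_upwards [Ioo_mem_nhdsGT (zero_lt_one (α := ℝ))] with t ht using h t ht

/-- Quadratic growth at the minimum of a strongly convex function. -/
lemma IsProx.growth {K : Set E} {u : E → ℝ} {Λ l : ℝ} {z y y' : E}
    (hu : StrongConvexOn K (-Λ) u) (h : IsProx K u l z y) (hy' : y' ∈ K) :
    u y + l / 2 * ‖y - z‖ ^ 2 + (l - Λ) / 2 * ‖y' - y‖ ^ 2 ≤ u y' + l / 2 * ‖y' - z‖ ^ 2 := by
  suffices (l - Λ) / 2 * ‖y' - y‖ ^ 2
      ≤ u y' + l / 2 * ‖y' - z‖ ^ 2 - (u y + l / 2 * ‖y - z‖ ^ 2) by linarith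
  -- Minimality is tested at `(1 - t) y + t y'`; after division by `t` the quadratic gain carries
  -- the factor `1 - t`, which tends to `1`.
  refine le_of_forall_one_sub_mul_le fun t ht => ?_
  have h0 : (0 : ℝ) ≤ 1 - t := by linarith [ht.2]
  have h1 := hu.2 h.1 hy' h0 ht.1.le (by ring)
  have h2 := h.2 _ (hu.1 h.1 hy' h0 ht.1.le (by ring))
  rw [norm_convexComb_sub_sq] at h2
  simp only [smul_eq_mul] at h1
  rw [norm_sub_rev y' y]
  refine le_of_mul_le_mul_left ?_ ht.1
  nlinarith

lemma IsProx.subgradAt {K : Set E} {u : E → ℝ} {Λ l : ℝ} {z y : E}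
    (hu : StrongConvexOn K (-Λ) u) (h : IsProx K u l z y) :
    SubgradAt K Λ u y (l • (z - y)) := by
  intro y' hy'
  have h1 := h.growth hu hy'
  have h2 : y' - z = (y' - y) - (z - y) := by abel
  rw [h2, norm_sub_sq_real (y' - y) (z - y), norm_sub_rev y z, real_inner_comm] at h1
  rw [inner_smul_left]
  simp only [conj_trivial]
  linarith

/-- Completing the square makes `y` the minimizer for the centre `y + p / l`. Thus any point with a
subgradient is a proximal point, where the envelope determines `u` exactly. -/
lemma SubgradAt.isProx {K : Set E} {u : E → ℝ} {Λ l : ℝ} {y p : E} (hl : 0 < l) (hΛ : Λ ≤ l)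
    (hy : y ∈ K) (h : SubgradAt K Λ u y p) : IsProx K u l (y + l⁻¹ • p) y := by
  refine ⟨hy, fun y' hy' => ?_⟩
  have h1 := h y' hy'
  have h2 : y' - (y + l⁻¹ • p) = (y' - y) - l⁻¹ • p := by abel
  have h3 : y - (y + l⁻¹ • p) = - (l⁻¹ • p) := by abel
  rw [h2, h3, norm_sub_sq_real (y' - y), norm_neg, inner_smul_right, real_inner_comm]
  have h4 : l / 2 * (2 * (l⁻¹ * ⟪p, y' - y⟫)) = ⟪p, y' - y⟫ := by field_simp
  nlinarith [sq_nonneg ‖y' - y‖]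

/-- The Moreau envelope of `u` over `K`, in terms of the proximal map `P`. -/
noncomputable def envelope (u : E → ℝ) (l : ℝ) (P : E → E) (z : E) : ℝ := u (P z) + l / 2 * ‖P z - z‖ ^ 2

section Envelope

variable {K : Set E} {u : E → ℝ} {Λ l : ℝ} {P : E → E}

omit [InnerProductSpace ℝ E] in
lemma envelope_le (hP : ∀ z, IsProx K u l z (P z)) (z : E) {y : E} (hy : y ∈ K) :
    envelope u l P z ≤ u y + l / 2 * ‖y - z‖ ^ 2 := (hP z).2 y hy

omit [InnerProductSpace ℝ E] in
lemma IsProx.envelope_eq (hP : ∀ z, IsProx K u l z (P z)) {z y : E} (h : IsProx K u l z y) :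
    envelope u l P z = u y + l / 2 * ‖y - z‖ ^ 2 :=
  le_antisymm (envelope_le hP z h.1) (h.2 _ (hP z).1)

/-- `P z` is a competitor in the problem centred at `z'`; no convexity is needed. -/
lemma envelope_le_add (hP : ∀ z, IsProx K u l z (P z)) (z z' : E) :
    envelope u l P z' ≤ envelope u l P z + ⟪l • (z - P z), z' - z⟫ + l / 2 * ‖z' - z‖ ^ 2 := by
  have h1 := envelope_le hP z' (hP z).1
  have h2 : P z - z' = (P z - z) - (z' - z) := by abel
  have h3 : z - P z = - (P z - z) := by abel
  rw [h2, norm_sub_sq_real (P z - z)] at h1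
  rw [h3, inner_smul_left, inner_neg_left]
  simp only [envelope, conj_trivial] at h1 ⊢
  linarith

/-- Using each proximal point as competitor for the other and adding the growth inequalities gives
the Lipschitz constant `l / (l - Λ) ≤ 2`. -/
lemma prox_dist_le (hu : StrongConvexOn K (-Λ) u) (hP : ∀ z, IsProx K u l z (P z))
    (hl : 0 < l) (hΛ : 2 * Λ ≤ l) (z z' : E) : ‖P z - P z'‖ ≤ 2 * ‖z - z'‖ := by
  have h1 := (hP z).growth hu (hP z').1
  have h2 := (hP z').growth hu (hP z).1
  have e1 : P z' - z = (P z' - z') + (z' - z) := by abel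
  have e2 : P z - z' = (P z - z) - (z' - z) := by abel
  rw [e1, norm_add_sq_real, norm_sub_rev (P z')] at h1
  rw [e2, norm_sub_sq_real (P z - z)] at h2
  have e3 : ⟪P z' - z', z' - z⟫ - ⟪P z - z, z' - z⟫
      = ⟪P z - P z', z - z'⟫ - ‖z - z'‖ ^ 2 := by
    rw [← inner_sub_left, ← real_inner_self_eq_norm_sq, ← inner_sub_left,
      ← neg_sub z z', inner_neg_right, ← inner_neg_left]
    congr 1; abel
  have h3 := real_inner_le_norm (P z - P z') (z - z')
  rw [norm_sub_rev z' z] at h1 h2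
  have h4 : l / 2 * ‖P z - P z'‖ ^ 2 ≤ l * (‖P z - P z'‖ * ‖z - z'‖) := by
    nlinarith [sq_nonneg ‖P z - P z'‖]
  by_contra! hc
  have h5 : 0 < ‖P z - P z'‖ := lt_of_le_of_lt (by positivity) hc
  nlinarith [mul_pos hl h5]

/-- The envelope inherits semiconvexity with a constant that does not grow with `l`; this keeps the
Hessian bounds uniform later. -/
lemma add_le_envelope (hu : StrongConvexOn K (-Λ) u) (hP : ∀ z, IsProx K u l z (P z))
    (hl : 0 < l) (hΛ0 : 0 ≤ Λ) (hΛ : 2 * Λ ≤ l) (z z' : E) :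
    envelope u l P z + ⟪l • (z - P z), z' - z⟫ - Λ * ‖z' - z‖ ^ 2 ≤ envelope u l P z' := by
  have h1 := (hP z).growth hu (hP z').1
  have e1 : P z' - z = (P z' - P z) + (P z - z) := by abel
  have e2 : P z' - z' = (P z' - P z) + (P z - z) - (z' - z) := by abel
  have e3 : z - P z = - (P z - z) := by abel
  rw [e1] at h1
  rw [envelope, envelope, e2, e3, norm_sub_sq_real ((P z' - P z) + (P z - z)), inner_smul_left,
    inner_neg_left, inner_add_left]
  simp only [conj_trivial]
  have h3 := real_inner_le_norm (P z' - P z) (z' - z)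
  have h4 : l * (‖P z' - P z‖ * ‖z' - z‖)
      ≤ (l - Λ) / 2 * ‖P z' - P z‖ ^ 2 + l / 2 * ‖z' - z‖ ^ 2 + Λ * ‖z' - z‖ ^ 2 := by
    -- After multiplication by `l - Λ`, completing the square leaves `Λ (l - 2 Λ) / 2 * ‖z' - z‖ ^
    -- 2`.
    have : 0 ≤ (l - Λ) * ((l - Λ) / 2 * ‖P z' - P z‖ ^ 2 + l / 2 * ‖z' - z‖ ^ 2
        + Λ * ‖z' - z‖ ^ 2 - l * (‖P z' - P z‖ * ‖z' - z‖)) := by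
      nlinarith [sq_nonneg ((l - Λ) * ‖P z' - P z‖ - l * ‖z' - z‖), 
        mul_nonneg (mul_nonneg hΛ0 (sub_nonneg.2 hΛ)) (sq_nonneg ‖z' - z‖)]
    rcases hΛ0.eq_or_lt with rfl | h0
    · nlinarith [nonneg_of_mul_nonneg_right this (by linarith)]
    · nlinarith [nonneg_of_mul_nonneg_right this (by linarith)]
  nlinarith

lemma hasGradientAt_envelope [CompleteSpace E] (hu : StrongConvexOn K (-Λ) u)
    (hP : ∀ z, IsProx K u l z (P z)) (hl : 0 < l) (hΛ0 : 0 ≤ Λ) (hΛ : 2 * Λ ≤ l) (z : E) :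
    HasGradientAt (envelope u l P) (l • (z - P z)) z := by
  rw [hasGradientAt_iff_isLittleO]
  refine Asymptotics.IsBigO.trans_isLittleO (g := fun z' => ‖z' - z‖ ^ 2) ?_ ?_
  · refine Asymptotics.IsBigO.of_bound l (Filter.Eventually.of_forall fun z' => ?_)
    have h1 := envelope_le_add hP z z'
    have h2 := add_le_envelope hu hP hl hΛ0 hΛ z z'
    rw [Real.norm_eq_abs, Real.norm_of_nonneg (by positivity), abs_le]
    constructor <;> nlinarith [sq_nonneg ‖z' - z‖]
  · exact Asymptotics.isLittleO_pow_sub_sub z one_lt_two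
end Envelope

end Prox

/-! ### Existence of subgradients and of proximal points -/

section Subgradient

variable {E : Type*} [NormedAddCommGroup E] [InnerProductSpace ℝ E] [FiniteDimensional ℝ E]

/-- A convex function on an open set has a subgradient at each point. -/
lemma exists_subgradient_of_convexOn {U : Set E} {g : E → ℝ} (hU : IsOpen U)
    (hg : ConvexOn ℝ U g) {x : E} (hx : x ∈ U) : ∃ p : E, ∀ y ∈ U, g x + ⟪p, y - x⟫ ≤ g y := by
  have hc : ContinuousOn g U := hg.continuousOn hU
  have hopen : IsOpen {p : E × ℝ | p.1 ∈ U ∧ g p.1 < p.2} := by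
    have h1 : ContinuousOn (fun p : E × ℝ => p.2 - g p.1) (Prod.fst ⁻¹' U) :=
      continuousOn_snd.sub (hc.comp continuousOn_fst fun _ h => h)
    convert h1.isOpen_inter_preimage (hU.preimage continuous_fst) (isOpen_Ioi (a := (0 : ℝ)))
      using 1
    ext p; simp
  -- Separate `(x, g x)` from the open strict epigraph. The point above it shows that the hyperplane
  -- is not vertical, so it is the graph of an affine minorant.
  obtain ⟨f, hf⟩ := geometric_hahn_banach_point_open hg.convex_strict_epigraph hopen
    (x := (x, g x)) (by simp)
  have hsplit : ∀ y : E, ∀ t : ℝ, f (y, t) = f (y, 0) + t * f (0, 1) := by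
    intro y t
    have : ((y, t) : E × ℝ) = (y, 0) + t • ((0 : E), (1 : ℝ)) := by simp
    rw [this, map_add, map_smul, smul_eq_mul]
  have hpos : 0 < f (0, 1) := by
    have := hf (x, g x + 1) ⟨hx, by simp⟩
    rw [hsplit x (g x), hsplit x (g x + 1)] at this
    linarith
  let φ : StrongDual ℝ E := -((f (0, 1))⁻¹ • (f.comp (ContinuousLinearMap.inl ℝ E ℝ)))
  refine ⟨(InnerProductSpace.toDual ℝ E).symm φ, fun y hy => ?_⟩
  rw [InnerProductSpace.toDual_symm_apply]
  have hle : ∀ t, g y < t → f (x, g x) ≤ f (y, t) := fun t ht => (hf (y, t) ⟨hy, ht⟩).le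
  have hle' : f (x, g x) ≤ f (y, g y) := by
    have h1 : Filter.Tendsto (fun t : ℝ => f (y, t)) (𝓝[>] (g y)) (𝓝 (f (y, g y))) :=
      (Continuous.tendsto (by fun_prop) (g y)).mono_left nhdsWithin_le_nhds
    refine ge_of_tendsto h1 ?_
    filter_upwards [self_mem_nhdsWithin] with t ht using hle t ht
  rw [hsplit x, hsplit y] at hle'
  have hφ : φ (y - x) = -((f (0, 1))⁻¹ * (f (y, 0) - f (x, 0))) := by
    have : f (y - x, 0) = f (y, 0) - f (x, 0) := by rw [← map_sub]; simp
    simp [φ, this]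
  rw [hφ]
  have : (f (0, 1))⁻¹ * (f (y, 0) - f (x, 0)) ≥ g x - g y := by
    rw [ge_iff_le, le_inv_mul_iff₀ hpos]
    linarith
  linarith

lemma exists_subgradAt {U : Set E} {u : E → ℝ} {Λ : ℝ} (hU : IsOpen U)
    (hu : StrongConvexOn U (-Λ) u) {x : E} (hx : x ∈ U) : ∃ p, SubgradAt U Λ u x p := by
  obtain ⟨p, hp⟩ := exists_subgradient_of_convexOn hU (strongConvexOn_iff_convex.1 hu) hx
  refine ⟨p - Λ • x, fun y hy => ?_⟩
  have h := hp y hy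
  have e : y = (y - x) + x := by abel
  have h2 : ‖y‖ ^ 2 = ‖y - x‖ ^ 2 + 2 * ⟪y - x, x⟫ + ‖x‖ ^ 2 := by
    conv_lhs => rw [e]
    exact norm_add_sq_real _ _
  rw [h2] at h
  rw [inner_sub_left, inner_smul_left]
  simp only [conj_trivial]
  rw [show ⟪x, y - x⟫ = ⟪y - x, x⟫ from real_inner_comm _ _]
  linarith

lemma StrongConvexOn.continuousOn_of_isOpen {U : Set E} {u : E → ℝ} {m : ℝ} (hU : IsOpen U)
    (hu : StrongConvexOn U m u) : ContinuousOn u U := by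
  have h1 := (strongConvexOn_iff_convex.1 hu).continuousOn hU
  have h2 : ContinuousOn (fun x : E => m / 2 * ‖x‖ ^ 2) U := by fun_prop
  refine (h1.add h2).congr fun x _ => by simp

omit [InnerProductSpace ℝ E] [FiniteDimensional ℝ E] in
lemma exists_isProx {K : Set E} {u : E → ℝ} (l : ℝ) (hK : IsCompact K) (hne : K.Nonempty)
    (hu : ContinuousOn u K) (z : E) : ∃ y, IsProx K u l z y := by
  obtain ⟨y, hy, hmin⟩ := hK.exists_isMinOn hne
    (f := fun y => u y + l / 2 * ‖y - z‖ ^ 2) (hu.add (by fun_prop))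
  exact ⟨y, hy, fun y' hy' => hmin hy'⟩

end Subgradient

/-! ### Second order expansions -/

section Inner

variable {E : Type*} [NormedAddCommGroup E] [InnerProductSpace ℝ E]

/-- Second order expansion of a function whose gradient is differentiable at a point. -/
lemma taylor_of_hasFDerivAt_gradient [CompleteSpace E] {f : E → ℝ} {g : E → E} {T : E →L[ℝ] E}
    {z : E} (hf : ∀ x, HasGradientAt f (g x) x) (hg : HasFDerivAt g T z) {η : ℝ} (hη : 0 < η) :
    ∃ δ > 0, ∀ h : E, ‖h‖ < δ →
      |f (z + h) - f z - ⟪g z, h⟫ - 1 / 2 * ⟪T h, h⟫| ≤ η * ‖h‖ ^ 2 := by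
  have h1 := hg.isLittleO.def hη
  obtain ⟨δ, hδ, hb⟩ := Metric.eventually_nhds_iff.1 h1
  refine ⟨δ, hδ, fun h hh => ?_⟩
  -- With the quadratic model subtracted along the segment, differentiability of `g` at the single
  -- point `z` bounds the derivative by `η ‖h‖ ^ 2`.
  set F : ℝ → ℝ := fun t => f (z + t • h) - t * ⟪g z, h⟫ - t ^ 2 / 2 * ⟪T h, h⟫ with hF
  have hd : ∀ t : ℝ, HasDerivAt F (⟪g (z + t • h), h⟫ - ⟪g z, h⟫ - t * ⟪T h, h⟫) t := by
    intro t
    have a1 : HasDerivAt (fun t : ℝ => z + t • h) h t := by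
      simpa using ((hasDerivAt_id t).smul_const h).const_add z
    have a2 : HasDerivAt (fun t : ℝ => f (z + t • h)) ⟪g (z + t • h), h⟫ t := by
      have := (hf (z + t • h)).hasFDerivAt.comp_hasDerivAt t a1
      exact this
    have a3 : HasDerivAt (fun t : ℝ => t * ⟪g z, h⟫) ⟪g z, h⟫ t := by
      simpa using (hasDerivAt_id t).mul_const ⟪g z, h⟫
    have a4 : HasDerivAt (fun t : ℝ => t ^ 2 / 2 * ⟪T h, h⟫) (t * ⟪T h, h⟫) t := by
      have := ((hasDerivAt_pow 2 t).div_const 2).mul_const ⟪T h, h⟫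
      rwa [show ((2 : ℕ) : ℝ) * t ^ (2 - 1) / 2 = t by norm_num] at this
    exact (a2.sub a3).sub a4
  have hbd : ∀ t ∈ Ico (0 : ℝ) 1,
      ‖⟪g (z + t • h), h⟫ - ⟪g z, h⟫ - t * ⟪T h, h⟫‖ ≤ η * ‖h‖ ^ 2 := by
    intro t ht
    have ht1 : ‖t • h‖ ≤ ‖h‖ := by
      rw [norm_smul, Real.norm_of_nonneg ht.1]
      exact mul_le_of_le_one_left (norm_nonneg _) ht.2.le
    have h2 := hb (y := z + t • h) (by simpa using ht1.trans_lt hh)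
    have h3 : ⟪g (z + t • h), h⟫ - ⟪g z, h⟫ - t * ⟪T h, h⟫
        = ⟪g (z + t • h) - g z - T (z + t • h - z), h⟫ := by
      rw [add_sub_cancel_left, map_smul, inner_sub_left, inner_sub_left, inner_smul_left]
      simp
    rw [h3]
    refine (norm_inner_le_norm _ _).trans ?_
    rw [add_sub_cancel_left] at h2
    calc _ ≤ (η * ‖t • h‖) * ‖h‖ := by
          rw [add_sub_cancel_left]; exact mul_le_mul_of_nonneg_right h2 (norm_nonneg _)
      _ ≤ (η * ‖h‖) * ‖h‖ := by gcongr
      _ = _ := by ring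
  have h4 := norm_image_sub_le_of_norm_deriv_le_segment_01' (f := F)
    (fun t _ => (hd t).hasDerivWithinAt) hbd
  have h5 : F 1 - F 0 = f (z + h) - f z - ⟪g z, h⟫ - 1 / 2 * ⟪T h, h⟫ := by
    simp [hF]; ring
  rwa [h5] at h4

/-- A quadratic inequality which holds asymptotically at the origin holds everywhere. -/
lemma quadratic_le_of_local {T : E →L[ℝ] E} {c : ℝ}
    (h : ∀ η > 0, ∃ δ > 0, ∀ x : E, ‖x‖ < δ → ⟪T x, x⟫ ≤ (c + η) * ‖x‖ ^ 2) (x : E) :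
    ⟪T x, x⟫ ≤ c * ‖x‖ ^ 2 := by
  rcases eq_or_ne x 0 with rfl | hx
  · simp
  have hx0 : 0 < ‖x‖ := norm_pos_iff.2 hx
  refine le_of_forall_pos_le_add fun ε hε => ?_
  obtain ⟨δ, hδ, hb⟩ := h (ε / ‖x‖ ^ 2) (by positivity)
  set t : ℝ := δ / (2 * ‖x‖) with ht
  have ht0 : 0 < t := by positivity
  have h1 := hb (t • x) (by
    rw [norm_smul, Real.norm_of_nonneg ht0.le, ht]
    field_simp
    linarith)
  rw [map_smul, inner_smul_left, inner_smul_right, norm_smul, Real.norm_of_nonneg ht0.le] at h1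
  simp only [conj_trivial] at h1
  have h2 : t ^ 2 * ⟪T x, x⟫ ≤ t ^ 2 * ((c + ε / ‖x‖ ^ 2) * ‖x‖ ^ 2) := by nlinarith
  have h3 := le_of_mul_le_mul_left h2 (by positivity)
  have h4 : (c + ε / ‖x‖ ^ 2) * ‖x‖ ^ 2 = c * ‖x‖ ^ 2 + ε := by field_simp
  linarith

end Inner

/-! ### Jensen's lemma -/

section Jensen

open MeasureTheory

variable {E : Type*} [NormedAddCommGroup E] [InnerProductSpace ℝ E] [FiniteDimensional ℝ E]
  [MeasurableSpace E] [BorelSpace E]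

/-- Jensen's lemma: at a strict maximum of a `C^{1,1}` function, the tilted function has its maximum
outside any given null set, for suitable small tilts. -/
lemma exists_tilted_max {f : E → ℝ} {g : E → E} {C : NNReal} (hf : ∀ x, HasGradientAt f (g x) x)
    (hg : LipschitzWith C g) {x₀ : E} {κ ρ δ : ℝ} (hκ : 0 < κ) (hδ : 0 < δ) (hδρ : δ < κ * ρ)
    (hmax : ∀ z ∈ Metric.closedBall x₀ ρ, f z ≤ f x₀ - κ * ‖z - x₀‖ ^ 2)
    {N : Set E} (hN : Measure.hausdorffMeasure (Module.finrank ℝ E : ℝ) N = 0) :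
    ∃ z ∉ N, κ * ‖z - x₀‖ ≤ δ ∧ ‖g z‖ < δ ∧
      ∀ z' ∈ Metric.closedBall x₀ ρ, f z' ≤ f z + ⟪g z, z' - z⟫ := by
  have hρ : 0 < ρ := by
    by_contra! h
    nlinarith
  by_contra! hcon
  -- Hausdorff measure of full dimension is controlled under Lipschitz maps and is positive on
  -- balls.
  set μ : Measure E := Measure.hausdorffMeasure (Module.finrank ℝ E : ℝ)
  -- Every small slope `p` is the gradient at a maximum of `f - ⟨p, ·⟩`. If all such points were in
  -- `N`, the null set `g '' N` would contain a ball.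
  have hsub : Metric.ball (0 : E) δ ⊆ g '' N := by
    intro p hp
    rw [mem_ball_zero_iff] at hp
    have hcf : Continuous f := continuous_iff_continuousAt.2 fun x => (hf x).continuousAt
    obtain ⟨z, hz, hzmax⟩ := (isCompact_closedBall x₀ ρ).exists_isMaxOn
      ⟨x₀, Metric.mem_closedBall_self hρ.le⟩
      (f := fun z => f z - ⟪p, z⟫) (by fun_prop)
    have h0 := hzmax (Metric.mem_closedBall_self hρ.le)
    simp only [mem_ofPred_eq] at h0
    have h1 := hmax z hz
    have h2 : ⟪p, x₀⟫ - ⟪p, z⟫ ≤ ‖p‖ * ‖z - x₀‖ := by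
      rw [← inner_sub_right, norm_sub_rev]; exact real_inner_le_norm _ _
    -- The strict maximum beats the tilt away from `x₀`; with `δ < κ * ρ` this puts `z` in the
    -- interior.
    have h3 : κ * ‖z - x₀‖ ≤ δ := by
      by_contra! hc
      have : 0 < ‖z - x₀‖ := by
        by_contra! h'
        nlinarith
      have h6 := mul_lt_mul_of_pos_right hc this
      have h7 := mul_lt_mul_of_pos_right hp this
      have h8 : κ * ‖z - x₀‖ ^ 2 = κ * ‖z - x₀‖ * ‖z - x₀‖ := by ring
      linarith
    have hzint : Metric.closedBall x₀ ρ ∈ 𝓝 z := by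
      refine Filter.mem_of_superset (Metric.isOpen_ball.mem_nhds ?_) Metric.ball_subset_closedBall
      rw [Metric.mem_ball, dist_eq_norm]
      nlinarith
    have hloc : IsLocalMax (fun z => f z - ⟪p, z⟫) z := hzmax.isLocalMax hzint
    have hgz : g z = p := by
      have hd : HasFDerivAt (fun z => f z - ⟪p, z⟫) (innerSL ℝ (g z) - innerSL ℝ p) z := by
        have := (hf z).hasFDerivAt
        exact this.sub (innerSL ℝ p).hasFDerivAt
      have := hloc.hasFDerivAt_eq_zero hd
      have h5 : innerSL ℝ (g z) = innerSL ℝ p := sub_eq_zero.1 this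
      refine ext_inner_right ℝ fun v => ?_
      have := congrArg (fun L => L v) h5
      simpa using this
    refine ⟨z, ?_, hgz⟩
    by_contra hzN
    obtain ⟨z', hz', hlt⟩ := hcon z hzN h3 (hgz ▸ hp)
    have := hzmax hz'
    simp only [mem_ofPred_eq] at this
    rw [hgz, inner_sub_right] at hlt
    linarith
  have h1 : μ (g '' N) = 0 := by
    refine le_antisymm ((hg.hausdorffMeasure_image_le (by positivity) N).trans ?_) zero_le
    rw [hN, mul_zero]
  have h2 : 0 < μ (Metric.ball (0 : E) δ) := Metric.measure_ball_pos μ 0 hδ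
  exact h2.ne' (measure_mono_null hsub h1)

end Jensen

/-! ### Bounds for quadratic forms -/

section Quadratic

variable {E : Type*} [NormedAddCommGroup E] [InnerProductSpace ℝ E]

lemma inner_add_inner_le_of_quadratic {T : E →L[ℝ] E} {C : ℝ}
    (hT : ∀ x, |⟪T x, x⟫| ≤ C * ‖x‖ ^ 2) (a b : E) :
    ⟪T a, b⟫ + ⟪T b, a⟫ ≤ C * (‖a‖ ^ 2 + ‖b‖ ^ 2) := by
  have h1 := (abs_le.1 (hT (a + b))).2
  have h2 := (abs_le.1 (hT (a - b))).1
  rw [norm_add_sq_real, map_add, inner_add_left, inner_add_right, inner_add_right] at h1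
  rw [norm_sub_sq_real, map_sub, inner_sub_left, inner_sub_right, inner_sub_right] at h2
  linarith

/-- Polarization with weights `√τ` and `1 / √τ`: the error on `k` is small, at the price of a large
one on `g`. -/
lemma quadratic_add_le {T : E →L[ℝ] E} {C τ : ℝ} (hτ : 0 < τ)
    (hT : ∀ x, |⟪T x, x⟫| ≤ C * ‖x‖ ^ 2) (k g : E) :
    ⟪T (k + g), k + g⟫ ≤ ⟪T k, k⟫ + C * τ * ‖k‖ ^ 2 + C * (1 + 1 / τ) * ‖g‖ ^ 2 := by
  have hs : 0 < √τ := Real.sqrt_pos.2 hτ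
  have h1 := inner_add_inner_le_of_quadratic hT (√τ • k) ((√τ)⁻¹ • g)
  rw [map_smul, map_smul, inner_smul_left, inner_smul_left, inner_smul_right, inner_smul_right,
    norm_smul, norm_smul, Real.norm_of_nonneg hs.le, Real.norm_of_nonneg (inv_nonneg.2 hs.le),
    mul_pow, mul_pow, inv_pow, Real.sq_sqrt hτ.le] at h1
  simp only [conj_trivial] at h1
  rw [mul_inv_cancel_left₀ hs.ne', inv_mul_cancel_left₀ hs.ne'] at h1
  have h2 := (abs_le.1 (hT g)).2
  rw [map_add, inner_add_left, inner_add_right, inner_add_right]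
  rw [one_div]
  linarith

variable [CompleteSpace E]

/-- The symmetric part of an operator with bounded quadratic form is bounded. -/
lemma norm_symmPart_le {T : E →L[ℝ] E} {C : ℝ} (hC : 0 ≤ C)
    (hT : ∀ x, |⟪T x, x⟫| ≤ C * ‖x‖ ^ 2) :
    ‖(1 / 2 : ℝ) • (T + ContinuousLinearMap.adjoint T)‖ ≤ C := by
  set S := (1 / 2 : ℝ) • (T + ContinuousLinearMap.adjoint T) with hS
  have hb : ∀ a b, ⟪S a, b⟫ ≤ C / 2 * (‖a‖ ^ 2 + ‖b‖ ^ 2) := by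
    intro a b
    have h := inner_add_inner_le_of_quadratic hT a b
    have : ⟪S a, b⟫ = 1 / 2 * (⟪T a, b⟫ + ⟪T b, a⟫) := by
      simp only [hS, smul_apply, add_apply,
        inner_smul_left, inner_add_left, ContinuousLinearMap.adjoint_inner_left, conj_trivial]
      rw [real_inner_comm (T b) a]
    rw [this]; linarith
  refine ContinuousLinearMap.opNorm_le_bound _ hC fun a => ?_
  by_contra! hlt
  have hSa : 0 < ‖S a‖ := lt_of_le_of_lt (by positivity) hlt
  have ha : 0 < ‖a‖ := norm_pos_iff.2 (by rintro rfl; simp at hSa)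
  -- The test vector points along `S a` and has the length of `a`, which balances the two squares.
  have h := hb a ((‖a‖ / ‖S a‖) • S a)
  rw [inner_smul_right, real_inner_self_eq_norm_sq, norm_smul, Real.norm_of_nonneg (by positivity),
    div_mul_cancel₀ _ hSa.ne'] at h
  have h3 : ‖a‖ / ‖S a‖ * ‖S a‖ ^ 2 = ‖a‖ * ‖S a‖ := by field_simp
  rw [h3] at h
  nlinarith [mul_lt_mul_of_pos_left hlt ha]

end Quadratic

/-! ### Transfer of second order information from the envelope to the function -/

section Touching

variable {E : Type*} [NormedAddCommGroup E] [InnerProductSpace ℝ E]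

/-- The quadratic polynomial with gradient `q` and Hessian form `S` at `y`, vanishing at `y`. -/
noncomputable def quad (y q : E) (S : E →L[ℝ] E) (x : E) : ℝ := ⟪q, x - y⟫ + 1 / 2 * ⟪S (x - y), x - y⟫

/-- The second order superjets of `u`. -/
def superjet (u : E → ℝ) : Set (E × E × (E →L[ℝ] E)) :=
  {j | IsLocalMax (fun x => u x - quad j.1 j.2.1 j.2.2 x) j.1}

lemma IsProx.eq {K : Set E} {u : E → ℝ} {Λ l : ℝ} {z y y' : E}
    (hu : StrongConvexOn K (-Λ) u) (hl : Λ < l) (h : IsProx K u l z y) (h' : IsProx K u l z y') :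
    y' = y := by
  have h1 := h.growth hu h'.1
  have h2 := h'.2 y h.1
  have h3 : ‖y' - y‖ ^ 2 ≤ 0 := by
    by_contra! hc
    nlinarith [mul_pos (sub_pos.2 hl) hc]
  have h4 : ‖y' - y‖ = 0 := by nlinarith [norm_nonneg (y' - y), sq_nonneg ‖y' - y‖]
  exact sub_eq_zero.1 (norm_eq_zero.1 h4)

/-- Subgradients are close to the gradient at a point of `C^{1,1}` contact. -/
lemma SubgradAt.norm_le_of_contact {x₀ : E} {r Λ s : ℝ} {u : E → ℝ} (hΛ : 0 < Λ)
    (hlow : SubgradAt (Metric.ball x₀ r) Λ u x₀ 0)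
    (hup : ∀ y ∈ Metric.ball x₀ r, u y ≤ u x₀ + Λ / 2 * ‖y - x₀‖ ^ 2) {y p : E} (hs : 0 < s)
    (hys : ‖y - x₀‖ ≤ s) (hsr : 2 * s < r) (hp : SubgradAt (Metric.ball x₀ r) Λ u y p) :
    ‖p‖ ≤ 3 * Λ * s := by
  rcases eq_or_ne p 0 with rfl | hp0
  · simp; positivity
  have hpp : 0 < ‖p‖ := norm_pos_iff.2 hp0
  -- A step of length `s` along `p` raises `u` by at least `s ‖p‖ - Λ s ^ 2 / 2`, while contact at
  -- `x₀` bounds the rise by `5 Λ s ^ 2 / 2`.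
  set h : E := (s / ‖p‖) • p with hh
  have hn : ‖h‖ = s := by
    rw [hh, norm_smul, Real.norm_of_nonneg (by positivity), div_mul_cancel₀ _ hpp.ne']
  have hi : ⟪p, h⟫ = s * ‖p‖ := by
    rw [hh, inner_smul_right, real_inner_self_eq_norm_sq]; field_simp
  have h0 : y + h - x₀ = (y - x₀) + h := by abel
  have h1 : ‖y + h - x₀‖ ≤ 2 * s := by
    rw [h0]; exact (norm_add_le _ _).trans (by linarith)
  have hmem : y + h ∈ Metric.ball x₀ r := by
    rw [mem_ball_iff_norm]; linarith
  have hy : y ∈ Metric.ball x₀ r := by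
    rw [mem_ball_iff_norm]; linarith
  have a1 := hp _ hmem
  have a2 := hlow _ hy
  have a3 := hup _ hmem
  rw [add_sub_cancel_left, hn, hi] at a1
  rw [inner_zero_left] at a2
  have a4 : ‖y - x₀‖ ^ 2 ≤ s ^ 2 := by gcongr
  have a5 : ‖y + h - x₀‖ ^ 2 ≤ (2 * s) ^ 2 := by gcongr
  have a6 : s * ‖p‖ ≤ s * (3 * Λ * s) := by nlinarith
  exact le_of_mul_le_mul_left a6 hs

/-- Second order upper estimates are transferred from the Moreau envelope to the function. -/
lemma local_upper_bound [FiniteDimensional ℝ E] {x₀ z : E} {r ρ₀ ρ Λ l τ : ℝ} {u : E → ℝ}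
    {P : E → E} {T : E →L[ℝ] E} (hΛ : 0 < Λ) (hu : StrongConvexOn (Metric.ball x₀ r) (-Λ) u)
    (hlow : SubgradAt (Metric.ball x₀ r) Λ u x₀ 0)
    (hup : ∀ y ∈ Metric.ball x₀ r, u y ≤ u x₀ + Λ / 2 * ‖y - x₀‖ ^ 2)
    (hρ₀ : ρ₀ < r) (hρ : 0 < ρ) (hρρ : ρ ≤ ρ₀)
    (hP : ∀ z, IsProx (Metric.closedBall x₀ ρ₀) u l z (P z)) (hl : 16 * Λ ≤ l)
    (hτ : 0 < τ) (hlτ : 4 * Λ * (1 + 1 / τ) ≤ l)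
    (hz : ‖P z - x₀‖ ≤ ρ / 5)
    (hquad : ∀ z' ∈ Metric.closedBall x₀ ρ,
      envelope u l P z' ≤ envelope u l P z + ⟪l • (z - P z), z' - z⟫ + 2 * Λ * ‖z' - z‖ ^ 2)
    (hT : ∀ η > 0, ∃ δ > 0, ∀ h : E, ‖h‖ < δ →
      |envelope u l P (z + h) - envelope u l P z - ⟪l • (z - P z), h⟫ - 1 / 2 * ⟪T h, h⟫|
        ≤ η * ‖h‖ ^ 2)
    (hTC : ∀ x, |⟪T x, x⟫| ≤ 4 * Λ * ‖x‖ ^ 2) :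
    ∃ δ > 0, ∀ k : E, ‖k‖ < δ → u (P z + k) ≤ u (P z) + ⟪l • (z - P z), k⟫ + 1 / 2 * ⟪T k, k⟫
      + 3 * Λ * τ * ‖k‖ ^ 2 := by
  have hl0 : 0 < l := by linarith
  have hsub : Metric.closedBall x₀ ρ₀ ⊆ Metric.ball x₀ r := Metric.closedBall_subset_ball hρ₀
  have huK : StrongConvexOn (Metric.closedBall x₀ ρ₀) (-Λ) u :=
    ⟨convex_closedBall _ _, fun x hx y hy => hu.2 (hsub hx) (hsub hy)⟩
  obtain ⟨δ, hδ, hTδ⟩ := hT (Λ * τ / 9) (by positivity)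
  refine ⟨min (ρ / 20) (δ / 3), by positivity, fun k hk => ?_⟩
  have hk1 : ‖k‖ < ρ / 20 := hk.trans_le (min_le_left _ _)
  have hk2 : ‖k‖ < δ / 3 := hk.trans_le (min_le_right _ _)
  set y := P z with hy
  have hy' : ‖y + k - x₀‖ ≤ ρ / 4 := by
    have : y + k - x₀ = (y - x₀) + k := by abel
    rw [this]; exact (norm_add_le _ _).trans (by linarith)
  have hyK : y + k ∈ Metric.closedBall x₀ ρ₀ := by
    rw [mem_closedBall_iff_norm]; linarith
  obtain ⟨p, hp⟩ := exists_subgradAt Metric.isOpen_ball hu (hsub hyK)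
  have hpn := hlow.norm_le_of_contact hΛ hup (s := ρ / 4) (by linarith) hy' (by linarith) hp
  have hprox := (hp.mono hsub).isProx hl0 (by linarith) hyK
  -- The centre whose proximal point is `y + k`. Below, `h` is the displacement of the centre and
  -- `g` its excess over the displacement `k` of the proximal point.
  set z' := y + k + l⁻¹ • p with hz'
  have hz'mem : z' ∈ Metric.closedBall x₀ ρ := by
    have e : z' - x₀ = (y + k - x₀) + l⁻¹ • p := by rw [hz']; abel
    have : ‖l⁻¹ • p‖ ≤ ρ / 4 := by
      rw [norm_smul, Real.norm_of_nonneg (by positivity), inv_mul_le_iff₀ hl0]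
      nlinarith
    rw [mem_closedBall_iff_norm, e]
    exact (norm_add_le _ _).trans (by linarith)
  have henv := hprox.envelope_eq hP
  set h := z' - z with hh
  set g := h - k with hg
  have hkg : h = k + g := by rw [hg]; abel
  have e1 : y + k - z' = (y - z) - g := by rw [hg, hh]; abel
  have hq : ⟪l • (z - y), h⟫ = ⟪l • (z - y), k⟫ - l * ⟪y - z, g⟫ := by
    rw [hkg, inner_add_right, inner_smul_left _ g, ← neg_sub y z, inner_neg_left]
    simp
    ring
  have hid : u (y + k) - u y - ⟪l • (z - y), k⟫
      = envelope u l P z' - envelope u l P z - ⟪l • (z - y), h⟫ - l / 2 * ‖g‖ ^ 2 := by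
    rw [henv, e1, norm_sub_sq_real (y - z) g, hq, envelope]
    ring
  have hA := hquad z' hz'mem
  have hlow1 := (hP z).subgradAt huK _ hyK
  rw [← hy, add_sub_cancel_left] at hlow1
  have hh2 : ‖h‖ ^ 2 ≤ 2 * (‖k‖ ^ 2 + ‖g‖ ^ 2) := by
    have := norm_add_le k g
    rw [hkg]
    nlinarith [sq_nonneg (‖k‖ - ‖g‖), norm_nonneg (k + g), norm_nonneg k, norm_nonneg g]
  -- The identity `hid`, the upper paraboloid of the envelope and the lower one of `u` give `l / 2
  -- ‖g‖ ^ 2 ≤ 2 Λ ‖h‖ ^ 2 + Λ / 2 ‖k‖ ^ 2`; then `l ≥ 16 Λ` absorbs the `g` part of `h`.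
  have hg2 : ‖g‖ ^ 2 ≤ 9 / 8 * ‖k‖ ^ 2 := by
    have : Λ * ‖g‖ ^ 2 ≤ Λ * (9 / 8 * ‖k‖ ^ 2) := by
      nlinarith [mul_le_mul_of_nonneg_right hl (sq_nonneg ‖g‖)]
    exact le_of_mul_le_mul_left this hΛ
  have hh3 : ‖h‖ ^ 2 ≤ 9 * ‖k‖ ^ 2 := by nlinarith [sq_nonneg ‖k‖]
  have hh4 : ‖h‖ ≤ 3 * ‖k‖ := by
    refine le_of_sq_le_sq ?_ (by positivity)
    rw [mul_pow]; linarith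
  have hB := (abs_le.1 (hTδ h (by linarith))).2
  have hzh : z + h = z' := by rw [hh]; abel
  rw [hzh] at hB
  have hC := quadratic_add_le hτ hTC k g
  rw [← hkg] at hC
  -- The term `-l / 2 ‖g‖ ^ 2` in `hid` absorbs the large Young error. What remains is `2 Λ τ` from
  -- Young and `Λ τ` from the expansion.
  have hD : 4 * Λ * (1 + 1 / τ) * ‖g‖ ^ 2 ≤ l * ‖g‖ ^ 2 := by gcongr
  have hE : Λ * τ / 9 * ‖h‖ ^ 2 ≤ Λ * τ / 9 * (9 * ‖k‖ ^ 2) := by gcongr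
  linarith

/-- At a point of twice differentiability of the Moreau envelope, the function has a superjet at the
corresponding proximal point. -/
lemma exists_superjet [FiniteDimensional ℝ E] {x₀ z : E} {r ρ₀ ρ Λ l τ : ℝ} {u : E → ℝ}
    {P : E → E} {P' : E →L[ℝ] E} (hΛ : 0 < Λ) (hu : StrongConvexOn (Metric.ball x₀ r) (-Λ) u)
    (hlow : SubgradAt (Metric.ball x₀ r) Λ u x₀ 0)
    (hup : ∀ y ∈ Metric.ball x₀ r, u y ≤ u x₀ + Λ / 2 * ‖y - x₀‖ ^ 2)
    (hρ₀ : ρ₀ < r) (hρ : 0 < ρ) (hρρ : ρ ≤ ρ₀)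
    (hP : ∀ z, IsProx (Metric.closedBall x₀ ρ₀) u l z (P z)) (hl : 16 * Λ ≤ l)
    (hτ : 0 < τ) (hτ1 : τ ≤ 1) (hlτ : 4 * Λ * (1 + 1 / τ) ≤ l)
    (hzx : ‖z - x₀‖ ≤ ρ / 10) (hz : ‖P z - x₀‖ ≤ ρ / 5)
    (hquad : ∀ z' ∈ Metric.closedBall x₀ ρ,
      envelope u l P z' ≤ envelope u l P z + ⟪l • (z - P z), z' - z⟫ + 2 * Λ * ‖z' - z‖ ^ 2)
    (hP' : HasFDerivAt P P' z) :
    ∃ S T : E →L[ℝ] E, ‖S‖ ≤ 10 * Λ ∧ (∀ x, ⟪S x, x⟫ = ⟪T x, x⟫ + 6 * Λ * τ * ‖x‖ ^ 2) ∧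
      (P z, l • (z - P z), S) ∈ superjet u ∧
      ∀ η > 0, ∃ δ > 0, ∀ h : E, ‖h‖ < δ →
        |envelope u l P (z + h) - envelope u l P z - ⟪l • (z - P z), h⟫ - 1 / 2 * ⟪T h, h⟫|
          ≤ η * ‖h‖ ^ 2 := by
  have hl0 : 0 < l := by linarith
  have hsub : Metric.closedBall x₀ ρ₀ ⊆ Metric.ball x₀ r := Metric.closedBall_subset_ball hρ₀
  have huK : StrongConvexOn (Metric.closedBall x₀ ρ₀) (-Λ) u :=
    ⟨convex_closedBall _ _, fun x hx y hy => hu.2 (hsub hx) (hsub hy)⟩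
  set T : E →L[ℝ] E := l • (ContinuousLinearMap.id ℝ E - P') with hTdef
  have hgrad : HasFDerivAt (fun z => l • (z - P z)) T z :=
    ((hasFDerivAt_id z).sub hP').const_smul l
  have hT : ∀ η > 0, ∃ δ > 0, ∀ h : E, ‖h‖ < δ →
      |envelope u l P (z + h) - envelope u l P z - ⟪l • (z - P z), h⟫ - 1 / 2 * ⟪T h, h⟫|
        ≤ η * ‖h‖ ^ 2 := fun η hη =>
    taylor_of_hasFDerivAt_gradient
      (fun x => hasGradientAt_envelope huK hP hl0 hΛ.le (by linarith) x) hgrad hη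
  have hTup : ∀ x, ⟪T x, x⟫ ≤ 4 * Λ * ‖x‖ ^ 2 := by
    refine quadratic_le_of_local fun η hη => ?_
    obtain ⟨δ, hδ, hb⟩ := hT (η / 2) (by positivity)
    refine ⟨min δ (ρ / 2), by positivity, fun h hh => ?_⟩
    have h1 := (abs_le.1 (hb h (hh.trans_le (min_le_left _ _)))).1
    have h2 := hquad (z + h) (by
      have : z + h - x₀ = (z - x₀) + h := by abel
      rw [mem_closedBall_iff_norm, this]
      exact (norm_add_le _ _).trans (by linarith [hh.trans_le (min_le_right _ _)]))
    rw [add_sub_cancel_left] at h2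
    linarith
  have hTlow : ∀ x, ⟪(-T) x, x⟫ ≤ 4 * Λ * ‖x‖ ^ 2 := by
    refine quadratic_le_of_local fun η hη => ?_
    obtain ⟨δ, hδ, hb⟩ := hT (η / 2) (by positivity)
    refine ⟨δ, hδ, fun h hh => ?_⟩
    have h1 := (abs_le.1 (hb h hh)).2
    have h2 := add_le_envelope huK hP hl0 hΛ.le (by linarith) z (z + h)
    rw [add_sub_cancel_left] at h2
    rw [neg_apply, inner_neg_left]
    nlinarith [sq_nonneg ‖h‖]
  have hTC : ∀ x, |⟪T x, x⟫| ≤ 4 * Λ * ‖x‖ ^ 2 := fun x => by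
    have := hTlow x
    rw [neg_apply, inner_neg_left] at this
    exact abs_le.2 ⟨by linarith, hTup x⟩
  obtain ⟨δ, hδ, hloc⟩ := local_upper_bound hΛ hu hlow hup hρ₀ hρ hρρ hP hl hτ hlτ hz hquad hT hTC
  -- Twice the error `3 Λ τ` is added to the symmetric part of `T`, so the local bound becomes
  -- touching; the norm is at most `4 Λ + 6 Λ`, whatever `l` is.
  set S : E →L[ℝ] E := (1 / 2 : ℝ) • (T + ContinuousLinearMap.adjoint T)
    + (6 * Λ * τ) • ContinuousLinearMap.id ℝ E with hS
  have hSx : ∀ x, ⟪S x, x⟫ = ⟪T x, x⟫ + 6 * Λ * τ * ‖x‖ ^ 2 := by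
    intro x
    simp only [hS, add_apply, smul_apply,
      inner_add_left, inner_smul_left, ContinuousLinearMap.adjoint_inner_left, conj_trivial,
      ContinuousLinearMap.id_apply, real_inner_self_eq_norm_sq]
    rw [real_inner_comm (T x) x]
    ring
  refine ⟨S, T, ?_, hSx, ?_, hT⟩
  · refine (norm_add_le _ _).trans ?_
    have h1 := norm_symmPart_le (by positivity) hTC
    have h2 : ‖(6 * Λ * τ) • ContinuousLinearMap.id ℝ E‖ ≤ 6 * Λ := by
      rw [norm_smul, Real.norm_of_nonneg (by positivity)]
      calc _ ≤ 6 * Λ * 1 * 1 := by gcongr; exact ContinuousLinearMap.norm_id_le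
        _ = _ := by ring
    linarith
  · change IsLocalMax _ _
    refine Metric.eventually_nhds_iff.2 ⟨δ, hδ, fun x hx => ?_⟩
    have h1 := hloc (x - P z) (by rwa [← dist_eq_norm])
    rw [add_sub_cancel] at h1
    simp only [quad, sub_self, inner_zero_right, map_zero, hSx]
    linarith

end Touching

/-! ### The theorem on sums for semiconvex functions -/

section Sums

open MeasureTheory

variable {E : Type*} [NormedAddCommGroup E] [InnerProductSpace ℝ E] [FiniteDimensional ℝ E]

omit [FiniteDimensional ℝ E] in
lemma envelope_contact {x₀ : E} {r ρ₀ Λ l : ℝ} {u : E → ℝ} {P : E → E} (hΛ : 0 < Λ)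
    (hlow : SubgradAt (Metric.ball x₀ r) Λ u x₀ 0) (hρ : 0 ≤ ρ₀) (hρ₀ : ρ₀ < r)
    (hP : ∀ z, IsProx (Metric.closedBall x₀ ρ₀) u l z (P z)) (hl : 16 * Λ ≤ l) :
    IsProx (Metric.closedBall x₀ ρ₀) u l x₀ x₀ ∧ envelope u l P x₀ = u x₀ := by
  have h := (hlow.mono (Metric.closedBall_subset_ball hρ₀)).isProx (l := l) (by linarith)
    (by linarith) (Metric.mem_closedBall_self hρ)
  rw [smul_zero, add_zero] at h
  refine ⟨h, ?_⟩
  rw [h.envelope_eq hP]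
  simp

/-- Jensen's lemma is applied to the sum of the two envelopes minus `κ ‖z - x₀‖ ^ 2`. At the point
found both proximal maps are differentiable, and the Hessians satisfy `T₁ + T₂ ≤ 2 κ`. The superjets
sit at `P₁ z` and `P₂ z`, both near `x₀`, and the passage to them adds `12 Λ τ`. -/
lemma exists_superjets_near {x₀ : E} {r Λ ε : ℝ} {u₁ u₂ : E → ℝ} (hr : 0 < r) (hΛ : 0 < Λ)
    (hu₁ : StrongConvexOn (Metric.ball x₀ r) (-Λ) u₁)
    (hu₂ : StrongConvexOn (Metric.ball x₀ r) (-Λ) u₂)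
    (hlow₁ : SubgradAt (Metric.ball x₀ r) Λ u₁ x₀ 0)
    (hlow₂ : SubgradAt (Metric.ball x₀ r) Λ u₂ x₀ 0)
    (hmax : ∀ y ∈ Metric.ball x₀ r, u₁ y + u₂ y ≤ u₁ x₀ + u₂ x₀) (hε : 0 < ε) :
    ∃ y₁ q₁ y₂ q₂ : E, ∃ S₁ S₂ : E →L[ℝ] E,
      ‖y₁ - x₀‖ ≤ ε ∧ ‖q₁‖ ≤ ε ∧ ‖y₂ - x₀‖ ≤ ε ∧ ‖q₂‖ ≤ ε ∧ ‖S₁‖ ≤ 10 * Λ ∧ ‖S₂‖ ≤ 10 * Λ ∧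
      (∀ x, ⟪S₁ x, x⟫ + ⟪S₂ x, x⟫ ≤ ε * ‖x‖ ^ 2) ∧
      (y₁, q₁, S₁) ∈ superjet u₁ ∧ (y₂, q₂, S₂) ∈ superjet u₂ := by
  borelize E
  obtain ⟨κ, hκ, hκΛ, hκε⟩ : ∃ κ : ℝ, 0 < κ ∧ κ ≤ Λ ∧ 4 * κ ≤ ε :=
    ⟨min Λ (ε / 4), by positivity, min_le_left _ _, by linarith [min_le_right Λ (ε / 4)]⟩
  obtain ⟨τ, hτ, hτ1, hτε⟩ : ∃ τ : ℝ, 0 < τ ∧ τ ≤ 1 ∧ 24 * Λ * τ ≤ ε := by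
    refine ⟨min 1 (ε / (24 * Λ)), by positivity, min_le_left _ _, ?_⟩
    calc 24 * Λ * min 1 (ε / (24 * Λ)) ≤ 24 * Λ * (ε / (24 * Λ)) := by
          gcongr; exact min_le_right _ _
      _ = ε := by field_simp
  obtain ⟨l, hl, hlτ⟩ : ∃ l : ℝ, 16 * Λ ≤ l ∧ 4 * Λ * (1 + 1 / τ) ≤ l :=
    ⟨max _ _, le_max_left _ _, le_max_right _ _⟩
  have hl0 : 0 < l := by linarith
  have hρ₀ : r / 2 < r := by linarith
  have hρ₀' : 0 < r / 2 := by linarith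
  have hsub : Metric.closedBall x₀ (r / 2) ⊆ Metric.ball x₀ r := Metric.closedBall_subset_ball hρ₀
  have hne : (Metric.closedBall x₀ (r / 2)).Nonempty := ⟨x₀, Metric.mem_closedBall_self hρ₀'.le⟩
  have huK₁ : StrongConvexOn (Metric.closedBall x₀ (r / 2)) (-Λ) u₁ :=
    ⟨convex_closedBall _ _, fun x hx y hy => hu₁.2 (hsub hx) (hsub hy)⟩
  have huK₂ : StrongConvexOn (Metric.closedBall x₀ (r / 2)) (-Λ) u₂ :=
    ⟨convex_closedBall _ _, fun x hx y hy => hu₂.2 (hsub hx) (hsub hy)⟩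
  choose P₁ hP₁ using exists_isProx l (isCompact_closedBall x₀ (r / 2)) hne
    ((StrongConvexOn.continuousOn_of_isOpen Metric.isOpen_ball hu₁).mono hsub)
  choose P₂ hP₂ using exists_isProx l (isCompact_closedBall x₀ (r / 2)) hne
    ((StrongConvexOn.continuousOn_of_isOpen Metric.isOpen_ball hu₂).mono hsub)
  have hup₁ : ∀ y ∈ Metric.ball x₀ r, u₁ y ≤ u₁ x₀ + Λ / 2 * ‖y - x₀‖ ^ 2 := fun y hy => by
    have h1 := hmax y hy
    have h2 := hlow₂ y hy
    rw [inner_zero_left] at h2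
    linarith
  have hup₂ : ∀ y ∈ Metric.ball x₀ r, u₂ y ≤ u₂ x₀ + Λ / 2 * ‖y - x₀‖ ^ 2 := fun y hy => by
    have h1 := hmax y hy
    have h2 := hlow₁ y hy
    rw [inner_zero_left] at h2
    linarith
  obtain ⟨hx₁, he₁⟩ := envelope_contact hΛ hlow₁ hρ₀'.le hρ₀ hP₁ hl
  obtain ⟨hx₂, he₂⟩ := envelope_contact hΛ hlow₂ hρ₀'.le hρ₀ hP₂ hl
  have hPx₁ : P₁ x₀ = x₀ := hx₁.eq huK₁ (by linarith) (hP₁ x₀)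
  have hPx₂ : P₂ x₀ = x₀ := hx₂.eq huK₂ (by linarith) (hP₂ x₀)
  have hlip₁ := prox_dist_le huK₁ hP₁ hl0 (by linarith)
  have hlip₂ := prox_dist_le huK₂ hP₂ hl0 (by linarith)
  have hL₁ : LipschitzWith 2 P₁ := LipschitzWith.of_dist_le_mul fun x y => by
    simpa [dist_eq_norm] using hlip₁ x y
  have hL₂ : LipschitzWith 2 P₂ := LipschitzWith.of_dist_le_mul fun x y => by
    simpa [dist_eq_norm] using hlip₂ x y
  obtain ⟨ρ, hρ, hρr, hρε⟩ : ∃ ρ : ℝ, 0 < ρ ∧ ρ ≤ r / 2 ∧ (l + 1) * ρ ≤ ε := by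
    refine ⟨min (r / 2) (ε / (l + 1)), by positivity, min_le_left _ _, ?_⟩
    calc (l + 1) * min (r / 2) (ε / (l + 1)) ≤ (l + 1) * (ε / (l + 1)) := by
          gcongr; exact min_le_right _ _
      _ = ε := by field_simp
  set e₁ := envelope u₁ l P₁ with he₁def
  set e₂ := envelope u₂ l P₂ with he₂def
  set f : E → ℝ := fun z => e₁ z + e₂ z - κ * ‖z - x₀‖ ^ 2 with hf
  set g : E → E := fun z => l • (z - P₁ z) + l • (z - P₂ z) - (2 * κ) • (z - x₀) with hg
  have hfg : ∀ z, HasGradientAt f (g z) z := by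
    intro z
    have h1 := (hasGradientAt_envelope huK₁ hP₁ hl0 hΛ.le (by linarith) z).hasFDerivAt
    have h2 := (hasGradientAt_envelope huK₂ hP₂ hl0 hΛ.le (by linarith) z).hasFDerivAt
    have h3 : HasFDerivAt (fun z => κ * ‖z - x₀‖ ^ 2)
        (InnerProductSpace.toDual ℝ E ((2 * κ) • (z - x₀))) z := by
      have h4 := (((hasFDerivAt_id z).sub_const x₀).norm_sq).const_mul κ
      refine h4.congr_fderiv ?_
      ext v
      simp
      ring
    rw [hasGradientAt_iff_hasFDerivAt, hg]
    simp only [map_sub, map_add]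
    exact (h1.add h2).sub h3
  have hgL : LipschitzWith (Real.toNNReal (6 * l + 2 * κ)) g := by
    refine LipschitzWith.of_dist_le_mul fun x y => ?_
    rw [Real.coe_toNNReal _ (by positivity), dist_eq_norm, dist_eq_norm]
    have e : g x - g y = l • ((x - y) - (P₁ x - P₁ y)) + l • ((x - y) - (P₂ x - P₂ y))
        - (2 * κ) • (x - y) := by simp only [hg]; module
    rw [e]
    have a1 : ‖l • ((x - y) - (P₁ x - P₁ y))‖ ≤ l * (3 * ‖x - y‖) := by
      rw [norm_smul, Real.norm_of_nonneg hl0.le]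
      have := norm_sub_le (x - y) (P₁ x - P₁ y)
      gcongr; linarith [hlip₁ x y]
    have a2 : ‖l • ((x - y) - (P₂ x - P₂ y))‖ ≤ l * (3 * ‖x - y‖) := by
      rw [norm_smul, Real.norm_of_nonneg hl0.le]
      have := norm_sub_le (x - y) (P₂ x - P₂ y)
      gcongr; linarith [hlip₂ x y]
    have a3 : ‖(2 * κ) • (x - y)‖ = 2 * κ * ‖x - y‖ := by
      rw [norm_smul, Real.norm_of_nonneg (by positivity)]
    refine (norm_sub_le _ _).trans ?_
    have := norm_add_le (l • ((x - y) - (P₁ x - P₁ y))) (l • ((x - y) - (P₂ x - P₂ y)))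
    linarith
  -- Envelopes lie below the functions and agree with them at `x₀`, so the maximum persists and the
  -- penalty makes it strict.
  have hfmax : ∀ z ∈ Metric.closedBall x₀ ρ, f z ≤ f x₀ - κ * ‖z - x₀‖ ^ 2 := by
    intro z hz
    have hzK : z ∈ Metric.closedBall x₀ (r / 2) := Metric.closedBall_subset_closedBall hρr hz
    have h1 := envelope_le hP₁ z hzK
    have h2 := envelope_le hP₂ z hzK
    have h3 := hmax z (hsub hzK)
    simp only [sub_self, norm_zero] at h1 h2
    simp only [hf, he₁, he₂, sub_self, norm_zero]
    linarith
  set μ : Measure E := Measure.hausdorffMeasure (Module.finrank ℝ E : ℝ) with hμ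
  have hN : μ ({z | DifferentiableAt ℝ P₁ z} ∩ {z | DifferentiableAt ℝ P₂ z})ᶜ = 0 :=
    (hL₁.ae_differentiableAt (μ := μ)).and (hL₂.ae_differentiableAt (μ := μ))
  obtain ⟨z, hzN, hzδ, -, hzmax⟩ := exists_tilted_max (δ := κ * (ρ / 10)) hfg hgL hκ (by positivity)
    (by nlinarith [mul_pos hκ hρ]) hfmax hN
  rw [notMem_compl_iff] at hzN
  have hd₁ : DifferentiableAt ℝ P₁ z := hzN.1
  have hd₂ : DifferentiableAt ℝ P₂ z := hzN.2
  have hzx : ‖z - x₀‖ ≤ ρ / 10 := le_of_mul_le_mul_left hzδ hκ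
  have hPz₁ : ‖P₁ z - x₀‖ ≤ ρ / 5 := by
    have := hlip₁ z x₀
    rw [hPx₁] at this; linarith
  have hPz₂ : ‖P₂ z - x₀‖ ≤ ρ / 5 := by
    have := hlip₂ z x₀
    rw [hPx₂] at this; linarith
  have hcomb : ∀ z' ∈ Metric.closedBall x₀ ρ, e₁ z' + e₂ z' ≤ e₁ z + e₂ z
      + ⟪l • (z - P₁ z), z' - z⟫ + ⟪l • (z - P₂ z), z' - z⟫ + κ * ‖z' - z‖ ^ 2 := by
    intro z' hz'
    have h1 := hzmax z' hz'
    have h2 : z' - x₀ = (z - x₀) + (z' - z) := by abel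
    simp only [hf, hg] at h1
    rw [h2, norm_add_sq_real, inner_sub_left (l • (z - P₁ z) + _), inner_add_left,
      inner_smul_left _ _ (2 * κ)] at h1
    simp only [conj_trivial] at h1
    linarith
  -- Semiconvexity of one envelope turns the upper bound on the sum into an upper bound on the
  -- other.
  have hq₁ : ∀ z' ∈ Metric.closedBall x₀ ρ,
      e₁ z' ≤ e₁ z + ⟪l • (z - P₁ z), z' - z⟫ + 2 * Λ * ‖z' - z‖ ^ 2 := by
    intro z' hz'
    have h1 := hcomb z' hz'
    have h2 := add_le_envelope huK₂ hP₂ hl0 hΛ.le (by linarith) z z'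
    nlinarith [mul_le_mul_of_nonneg_right hκΛ (sq_nonneg ‖z' - z‖)]
  have hq₂ : ∀ z' ∈ Metric.closedBall x₀ ρ,
      e₂ z' ≤ e₂ z + ⟪l • (z - P₂ z), z' - z⟫ + 2 * Λ * ‖z' - z‖ ^ 2 := by
    intro z' hz'
    have h1 := hcomb z' hz'
    have h2 := add_le_envelope huK₁ hP₁ hl0 hΛ.le (by linarith) z z'
    nlinarith [mul_le_mul_of_nonneg_right hκΛ (sq_nonneg ‖z' - z‖)]
  obtain ⟨S₁, T₁, hS₁, hST₁, hj₁, hT₁⟩ := exists_superjet hΛ hu₁ hlow₁ hup₁ hρ₀ hρ hρr hP₁ hl hτ hτ1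
    hlτ hzx hPz₁ hq₁ hd₁.hasFDerivAt
  obtain ⟨S₂, T₂, hS₂, hST₂, hj₂, hT₂⟩ := exists_superjet hΛ hu₂ hlow₂ hup₂ hρ₀ hρ hρr hP₂ hl hτ hτ1
    hlτ hzx hPz₂ hq₂ hd₂.hasFDerivAt
  have hρε' : ρ ≤ ε := by nlinarith
  have hgrad_le : ∀ w : E, ‖w - x₀‖ ≤ ρ / 5 → ‖l • (z - w)‖ ≤ ε := by
    intro w hw
    rw [norm_smul, Real.norm_of_nonneg hl0.le]
    have h1 : ‖z - w‖ ≤ ρ := by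
      have : z - w = (z - x₀) - (w - x₀) := by abel
      rw [this]
      exact (norm_sub_le _ _).trans (by linarith)
    nlinarith
  refine ⟨P₁ z, l • (z - P₁ z), P₂ z, l • (z - P₂ z), S₁, S₂, by linarith, hgrad_le _ hPz₁,
    by linarith, hgrad_le _ hPz₂, hS₁, hS₂, fun x => ?_, hj₁, hj₂⟩
  have hT : ∀ x, ⟪(T₁ + T₂) x, x⟫ ≤ 2 * κ * ‖x‖ ^ 2 := by
    refine quadratic_le_of_local fun η hη => ?_
    obtain ⟨δ₁, hδ₁, hb₁⟩ := hT₁ (η / 4) (by positivity)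
    obtain ⟨δ₂, hδ₂, hb₂⟩ := hT₂ (η / 4) (by positivity)
    refine ⟨min (min δ₁ δ₂) (ρ / 2), by positivity, fun h hh => ?_⟩
    have hh1 := hh.trans_le (min_le_left _ _)
    have h1 := (abs_le.1 (hb₁ h (hh1.trans_le (min_le_left _ _)))).1
    have h2 := (abs_le.1 (hb₂ h (hh1.trans_le (min_le_right _ _)))).1
    have h3 := hcomb (z + h) (by
      have : z + h - x₀ = (z - x₀) + h := by abel
      rw [mem_closedBall_iff_norm, this]
      exact (norm_add_le _ _).trans (by linarith [hh.trans_le (min_le_right _ _)]))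
    rw [add_sub_cancel_left] at h3
    rw [add_apply, inner_add_left]
    linarith
  have h1 := hT x
  rw [add_apply, inner_add_left] at h1
  rw [hST₁, hST₂]
  nlinarith [sq_nonneg ‖x‖, mul_le_mul_of_nonneg_right hκε (sq_nonneg ‖x‖),
    mul_le_mul_of_nonneg_right hτε (sq_nonneg ‖x‖)]

/-- At a maximum of a sum of semiconvex functions there is a common gradient. -/
lemma exists_common_gradient {x₀ : E} {r Λ : ℝ} {u₁ u₂ : E → ℝ} (hr : 0 < r)
    (hu₁ : StrongConvexOn (Metric.ball x₀ r) (-Λ) u₁)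
    (hu₂ : StrongConvexOn (Metric.ball x₀ r) (-Λ) u₂)
    (hmax : ∀ y ∈ Metric.ball x₀ r, u₁ y + u₂ y ≤ u₁ x₀ + u₂ x₀) :
    ∃ q : E, SubgradAt (Metric.ball x₀ r) Λ u₁ x₀ q ∧ SubgradAt (Metric.ball x₀ r) Λ u₂ x₀ (-q) := by
  obtain ⟨p₁, hp₁⟩ := exists_subgradAt Metric.isOpen_ball hu₁ (Metric.mem_ball_self hr)
  obtain ⟨p₂, hp₂⟩ := exists_subgradAt Metric.isOpen_ball hu₂ (Metric.mem_ball_self hr)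
  suffices p₁ + p₂ = 0 by
    refine ⟨p₁, hp₁, ?_⟩
    rwa [← eq_neg_of_add_eq_zero_right this]
  -- A move along `p₁ + p₂` gains to first order `t ‖p₁ + p₂‖ ^ 2` and loses only `O(t ^ 2)`, which
  -- maximality forbids for small `t`.
  have key : ∀ t : ℝ, 0 < t → t * ‖p₁ + p₂‖ < r → t * ‖p₁ + p₂‖ ^ 2 ≤ Λ * t ^ 2 * ‖p₁ + p₂‖ ^ 2 := by
    intro t ht htr
    have hn : ‖t • (p₁ + p₂)‖ = t * ‖p₁ + p₂‖ := by
      rw [norm_smul, Real.norm_of_nonneg ht.le]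
    have hmem : x₀ + t • (p₁ + p₂) ∈ Metric.ball x₀ r := by
      rw [mem_ball_iff_norm, add_sub_cancel_left, hn]; exact htr
    have h1 := hp₁ _ hmem
    have h2 := hp₂ _ hmem
    have h3 := hmax _ hmem
    rw [add_sub_cancel_left, hn] at h1 h2
    have h4 : ⟪p₁, t • (p₁ + p₂)⟫ + ⟪p₂, t • (p₁ + p₂)⟫ = t * ‖p₁ + p₂‖ ^ 2 := by
      rw [← inner_add_left, inner_smul_right, real_inner_self_eq_norm_sq]
    nlinarith
  by_contra hne
  have hpos : 0 < ‖p₁ + p₂‖ := norm_pos_iff.2 hne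
  set t : ℝ := min (r / (2 * ‖p₁ + p₂‖)) (1 / (2 * (|Λ| + 1))) with ht
  have ht0 : 0 < t := by positivity
  have ht1 : t * ‖p₁ + p₂‖ < r := by
    calc t * ‖p₁ + p₂‖ ≤ r / (2 * ‖p₁ + p₂‖) * ‖p₁ + p₂‖ := by gcongr; exact min_le_left _ _
      _ = r / 2 := by field_simp
      _ < r := by linarith
  have ht2 : Λ * t < 1 := by
    calc Λ * t ≤ (|Λ| + 1) * t := by gcongr; linarith [le_abs_self Λ]
      _ ≤ (|Λ| + 1) * (1 / (2 * (|Λ| + 1))) := by gcongr; exact min_le_right _ _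
      _ = 1 / 2 := by field_simp
      _ < 1 := by norm_num
  have h := key t ht0 ht1
  have : 0 < t * ‖p₁ + p₂‖ ^ 2 := by positivity
  nlinarith

omit [FiniteDimensional ℝ E] in
lemma SubgradAt.sub_inner {K : Set E} {Λ : ℝ} {u : E → ℝ} {y p : E} (q : E)
    (h : SubgradAt K Λ u y p) : SubgradAt K Λ (fun x => u x - ⟪q, x⟫) y (p - q) := by
  intro y' hy'
  have := h y' hy'
  rw [inner_sub_left, inner_sub_right q]
  linarith

omit [FiniteDimensional ℝ E] in
lemma StrongConvexOn.sub_inner {K : Set E} {m : ℝ} {u : E → ℝ} (q : E)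
    (h : StrongConvexOn K m u) : StrongConvexOn K m (fun x => u x - ⟪q, x⟫) := by
  refine ⟨h.1, fun x hx y hy a b ha hb hab => ?_⟩
  have := h.2 hx hy ha hb hab
  simp only [inner_add_right, inner_smul_right, smul_eq_mul] at this ⊢
  linarith

omit [FiniteDimensional ℝ E] in
lemma superjet_of_sub_inner {u : E → ℝ} {q y p : E} {S : E →L[ℝ] E}
    (h : (y, p, S) ∈ superjet (fun x => u x - ⟪q, x⟫)) : (y, p + q, S) ∈ superjet u := by
  change IsLocalMax _ _ at h
  change IsLocalMax _ _
  filter_upwards [h] with x hx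
  simp only [quad, inner_add_left, inner_sub_right] at hx ⊢
  linarith

/-- The theorem on sums for semiconvex functions. -/
theorem exists_superjets_closure {x₀ q : E} {r Λ : ℝ} {u₁ u₂ : E → ℝ} (hr : 0 < r) (hΛ : 0 < Λ)
    (hu₁ : StrongConvexOn (Metric.ball x₀ r) (-Λ) u₁)
    (hu₂ : StrongConvexOn (Metric.ball x₀ r) (-Λ) u₂)
    (hq₁ : SubgradAt (Metric.ball x₀ r) Λ u₁ x₀ q)
    (hq₂ : SubgradAt (Metric.ball x₀ r) Λ u₂ x₀ (-q))
    (hmax : ∀ y ∈ Metric.ball x₀ r, u₁ y + u₂ y ≤ u₁ x₀ + u₂ x₀) :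
    ∃ S₁ S₂ : E →L[ℝ] E, (∀ x, ⟪S₁ x, x⟫ + ⟪S₂ x, x⟫ ≤ 0) ∧
      (x₀, q, S₁) ∈ closure (superjet u₁) ∧ (x₀, -q, S₂) ∈ closure (superjet u₂) := by
  have hq₁' := hq₁.sub_inner q
  have hq₂' := hq₂.sub_inner (-q)
  rw [sub_self] at hq₁' hq₂'
  have hex : ∀ k : ℕ, _ := fun k => exists_superjets_near (ε := 1 / ((k : ℝ) + 1)) hr hΛ
    (StrongConvexOn.sub_inner q hu₁) (StrongConvexOn.sub_inner (-q) hu₂) hq₁' hq₂'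
    (fun y hy => by simp only [inner_neg_left]; linarith [hmax y hy]) (by positivity)
  choose y₁ p₁ y₂ p₂ S₁ S₂ hy₁ hp₁ hy₂ hp₂ hS₁ hS₂ hS hj₁ hj₂ using hex
  have h0 : Filter.Tendsto (fun k : ℕ => 1 / ((k : ℝ) + 1)) Filter.atTop (𝓝 0) :=
    tendsto_one_div_add_atTop_nhds_zero_nat
  -- The bound `10 Λ` is independent of `k`, so the Hessians subconverge in finite dimension.
  obtain ⟨⟨L₁, L₂⟩, -, φ, hφ, hL⟩ :=
    ((isCompact_closedBall (0 : E →L[ℝ] E) (10 * Λ)).prod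
      (isCompact_closedBall (0 : E →L[ℝ] E) (10 * Λ))).tendsto_subseq
      (x := fun k => (S₁ k, S₂ k)) (fun k => ⟨by simpa using hS₁ k, by simpa using hS₂ k⟩)
  have hL₁ : Filter.Tendsto (fun k => S₁ (φ k)) Filter.atTop (𝓝 L₁) :=
    (continuous_fst.tendsto _).comp hL
  have hL₂ : Filter.Tendsto (fun k => S₂ (φ k)) Filter.atTop (𝓝 L₂) :=
    (continuous_snd.tendsto _).comp hL
  have h0φ := h0.comp hφ.tendsto_atTop
  have hlim : ∀ y : ℕ → E, ∀ a : E, (∀ k, ‖y k - a‖ ≤ 1 / ((k : ℝ) + 1)) →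
      Filter.Tendsto (fun k => y (φ k)) Filter.atTop (𝓝 a) := fun y a h =>
    tendsto_iff_norm_sub_tendsto_zero.2
      (squeeze_zero (fun _ => norm_nonneg _) (fun k => h (φ k)) h0φ)
  refine ⟨L₁, L₂, fun x => ?_, ?_, ?_⟩
  · have t1 : Filter.Tendsto (fun k => ⟪S₁ (φ k) x, x⟫ + ⟪S₂ (φ k) x, x⟫) Filter.atTop
        (𝓝 (⟪L₁ x, x⟫ + ⟪L₂ x, x⟫)) :=
      ((((ContinuousLinearMap.apply ℝ E x).continuous.tendsto L₁).comp hL₁).inner tendsto_const_nhds).add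
        ((((ContinuousLinearMap.apply ℝ E x).continuous.tendsto L₂).comp hL₂).inner tendsto_const_nhds)
    have t2 : Filter.Tendsto (fun k => 1 / (((φ k : ℕ) : ℝ) + 1) * ‖x‖ ^ 2) Filter.atTop
        (𝓝 (0 * ‖x‖ ^ 2)) := h0φ.mul_const _
    rw [zero_mul] at t2
    exact le_of_tendsto_of_tendsto' t1 t2 fun k => hS (φ k) x
  · refine mem_closure_of_tendsto ((hlim y₁ x₀ hy₁).prodMk_nhds
      ((hlim (fun k => p₁ k + q) q (by simpa using hp₁)).prodMk_nhds hL₁))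
      (Filter.Eventually.of_forall fun k => superjet_of_sub_inner (hj₁ (φ k)))
  · refine mem_closure_of_tendsto ((hlim y₂ x₀ hy₂).prodMk_nhds
      ((hlim (fun k => p₂ k + -q) (-q) (by simpa using hp₂)).prodMk_nhds hL₂))
      (Filter.Eventually.of_forall fun k => superjet_of_sub_inner (hj₂ (φ k)))

end Sums

/-! ### The operator and viscosity tests in a chart -/

section Coordinates

variable {n m : ℕ} {M : Type*} [TopologicalSpace M] [ChartedSpace (EuclideanSpace ℝ (Fin n)) M]

/-- The coordinate expression of the vector field `V` in the chart `e`. -/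
noncomputable def coordField (e : OpenPartialHomeomorph M (EuclideanSpace ℝ (Fin n)))
    (V : (x : M) → TangentSpace (𝓡 n) x) :
    EuclideanSpace ℝ (Fin n) → EuclideanSpace ℝ (Fin n) :=
  fun x => VectorField.mpullback (𝓡 n) (𝓡 n) e.symm V x

variable {e : OpenPartialHomeomorph M (EuclideanSpace ℝ (Fin n))}

lemma mdifferentiable_of_mem_maximalAtlas (he : e ∈ IsManifold.maximalAtlas (𝓡 n) ∞ M) :
    e.MDifferentiable (𝓡 n) (𝓡 n) :=
  ⟨(contMDiffOn_of_mem_maximalAtlas he).mdifferentiableOn (by simp),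
    (contMDiffOn_symm_of_mem_maximalAtlas he).mdifferentiableOn (by simp)⟩

lemma isInvertible_mfderiv_symm (he : e ∈ IsManifold.maximalAtlas (𝓡 n) ∞ M)
    {x : EuclideanSpace ℝ (Fin n)} (hx : x ∈ e.target) :
    (mfderiv (𝓡 n) (𝓡 n) e.symm x).IsInvertible :=
  ⟨(mdifferentiable_of_mem_maximalAtlas he).symm.mfderiv hx, rfl⟩

lemma contDiffAt_coordField [IsManifold (𝓡 n) ∞ M]
    (he : e ∈ IsManifold.maximalAtlas (𝓡 n) ∞ M)
    {V : (x : M) → TangentSpace (𝓡 n) x}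
    (hV : ContMDiff (𝓡 n) (𝓡 n).tangent ∞ (fun x => (⟨x, V x⟩ : TangentBundle (𝓡 n) M)))
    {x : EuclideanSpace ℝ (Fin n)} (hx : x ∈ e.target) :
    ContDiffAt ℝ ∞ (coordField e V) x := by
  refine contMDiffAt_vectorSpace_iff_contDiffAt.1 ?_
  exact ContMDiffAt.mpullback_vectorField_preimage (n := ∞) (hV (e.symm x))
    (contMDiffAt_symm_of_mem_maximalAtlas he hx) (isInvertible_mfderiv_symm he hx) (by simp)

lemma mdifferentiableAt_of_comp_symm (he : e ∈ IsManifold.maximalAtlas (𝓡 n) ∞ M)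
    {f : M → ℝ} {x : EuclideanSpace ℝ (Fin n)} (hx : x ∈ e.target)
    (hf : DifferentiableAt ℝ (f ∘ e.symm) x) : MDifferentiableAt (𝓡 n) 𝓘(ℝ, ℝ) f (e.symm x) := by
  have h1 : MDifferentiableAt (𝓡 n) 𝓘(ℝ, ℝ) (f ∘ e.symm) (e (e.symm x)) := by
    rw [e.right_inv hx]; exact hf.mdifferentiableAt
  have h2 := h1.comp (e.symm x)
    ((mdifferentiable_of_mem_maximalAtlas he).mdifferentiableAt (e.map_target hx))
  refine h2.congr_of_eventuallyEq ?_
  filter_upwards [e.open_source.mem_nhds (e.map_target hx)] with y hy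
  simp [e.left_inv hy]

lemma along_symm_apply (he : e ∈ IsManifold.maximalAtlas (𝓡 n) ∞ M)
    (V : (x : M) → TangentSpace (𝓡 n) x) {f : M → ℝ} {x : EuclideanSpace ℝ (Fin n)}
    (hx : x ∈ e.target) (hf : DifferentiableAt ℝ (f ∘ e.symm) x) :
    along V f (e.symm x) = fderiv ℝ (f ∘ e.symm) x (coordField e V x) := by
  have h1 := mdifferentiableAt_of_comp_symm he hx hf
  have h2 := (mdifferentiable_of_mem_maximalAtlas he).mdifferentiableAt_symm hx
  have h3 := mfderiv_comp x h1 h2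
  rw [mfderiv_eq_fderiv] at h3
  rw [h3]
  change _ = (mfderiv (𝓡 n) 𝓘(ℝ, ℝ) f (e.symm x)) ((mfderiv (𝓡 n) (𝓡 n) e.symm x)
    ((mfderiv (𝓡 n) (𝓡 n) e.symm x).inverse (V (e.symm x))))
  rw [(isInvertible_mfderiv_symm he hx).self_apply_inverse]
  rfl

/-- The horizontal gradient in coordinates: `s` are the fields, `p` the differential. -/
def coordGrad {E : Type*} [NormedAddCommGroup E] [NormedSpace ℝ E] (s : Fin m → E → E) (x : E)
    (p : E →L[ℝ] ℝ) : Fin m → ℝ := fun i => p (s i x)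

/-- The symmetrized horizontal Hessian in coordinates. -/
noncomputable def coordHess {E : Type*} [NormedAddCommGroup E] [NormedSpace ℝ E]
    (s : Fin m → E → E) (x : E) (p : E →L[ℝ] ℝ) (B : E →L[ℝ] E →L[ℝ] ℝ) :
    Matrix (Fin m) (Fin m) ℝ :=
  Matrix.of fun i j => ((B (s i x) (s j x) + p (fderiv ℝ (s j) x (s i x)))
    + (B (s j x) (s i x) + p (fderiv ℝ (s i) x (s j x)))) / 2

/-- The quasilinear operator, as a function of the gradient and the Hessian. -/
def opFun (A : (Fin m → ℝ) → Matrix (Fin m) (Fin m) ℝ) (H : (Fin m → ℝ) → ℝ) (ξ : Fin m → ℝ)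
    (Y : Matrix (Fin m) (Fin m) ℝ) : ℝ := -(A ξ * Y).trace + H ξ

lemma hgrad_symm_apply (he : e ∈ IsManifold.maximalAtlas (𝓡 n) ∞ M)
    (X : Fin m → (x : M) → TangentSpace (𝓡 n) x) {f : M → ℝ} {x : EuclideanSpace ℝ (Fin n)}
    (hx : x ∈ e.target) (hf : DifferentiableAt ℝ (f ∘ e.symm) x) :
    hgrad X f (e.symm x) = coordGrad (fun i => coordField e (X i)) x (fderiv ℝ (f ∘ e.symm) x) := by
  ext i
  exact along_symm_apply he (X i) hx hf

lemma along_along_symm_apply [IsManifold (𝓡 n) ∞ M]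
    (he : e ∈ IsManifold.maximalAtlas (𝓡 n) ∞ M)
    {V W : (x : M) → TangentSpace (𝓡 n) x}
    (hW : ContMDiff (𝓡 n) (𝓡 n).tangent ∞ (fun x => (⟨x, W x⟩ : TangentBundle (𝓡 n) M)))
    {f : M → ℝ} {x : EuclideanSpace ℝ (Fin n)}
    (hx : x ∈ e.target) (hf : ContDiffAt ℝ 2 (f ∘ e.symm) x) :
    along V (along W f) (e.symm x)
      = fderiv ℝ (fderiv ℝ (f ∘ e.symm)) x (coordField e V x) (coordField e W x)
        + fderiv ℝ (f ∘ e.symm) x (fderiv ℝ (coordField e W) x (coordField e V x)) := by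
  have h1 : along W f ∘ e.symm =ᶠ[𝓝 x]
      fun y => fderiv ℝ (f ∘ e.symm) y (coordField e W y) := by
    filter_upwards [e.open_target.mem_nhds hx, hf.eventually (by simp)] with y hy hfy
    exact along_symm_apply he W hy (hfy.differentiableAt (by simp))
  have h2 : DifferentiableAt ℝ (fderiv ℝ (f ∘ e.symm)) x :=
    (hf.fderiv_right (m := 1) (by norm_num)).differentiableAt (by simp)
  have h3 : DifferentiableAt ℝ (coordField e W) x :=
    (contDiffAt_coordField he hW hx).differentiableAt (by simp)
  have h4 := h2.hasFDerivAt.clm_apply h3.hasFDerivAt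
  have h5 : HasFDerivAt (along W f ∘ e.symm) _ x := h4.congr_of_eventuallyEq h1
  rw [along_symm_apply he V hx h5.differentiableAt, h5.fderiv]
  simp
  ring

lemma hhess_symm_apply [IsManifold (𝓡 n) ∞ M]
    (he : e ∈ IsManifold.maximalAtlas (𝓡 n) ∞ M)
    {X : Fin m → (x : M) → TangentSpace (𝓡 n) x}
    (hX : ∀ i, ContMDiff (𝓡 n) (𝓡 n).tangent ∞
      (fun x => (⟨x, X i x⟩ : TangentBundle (𝓡 n) M)))
    {f : M → ℝ} {x : EuclideanSpace ℝ (Fin n)}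
    (hx : x ∈ e.target) (hf : ContDiffAt ℝ 2 (f ∘ e.symm) x) :
    hhess X f (e.symm x) = coordHess (fun i => coordField e (X i)) x (fderiv ℝ (f ∘ e.symm) x)
      (fderiv ℝ (fderiv ℝ (f ∘ e.symm)) x) := by
  ext i j
  simp only [hhess, coordHess, Matrix.of_apply, along_along_symm_apply he (hX _) hx hf]

/-- A function touched from above locally, in a chart, by a `C²` function is touched from above
globally by a `C²` function with the same germ. -/
lemma exists_global_test [T2Space M] (he : e ∈ IsManifold.maximalAtlas (𝓡 n) ∞ M)
    {Ω : Set M} {w : M → ℝ} {C : ℝ} (hC : ∀ y ∈ Ω, w y ≤ C) {x : EuclideanSpace ℝ (Fin n)}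
    (hx : x ∈ e.target) {F : EuclideanSpace ℝ (Fin n) → ℝ} (hF : ContDiff ℝ 2 F)
    (hmax : IsLocalMax (fun y => w (e.symm y) - F y) x) :
    ∃ ψ : M → ℝ, ContMDiff (𝓡 n) 𝓘(ℝ, ℝ) 2 ψ ∧ ψ ∘ e.symm =ᶠ[𝓝 x] F ∧
      IsMaxOn (fun y => w y - ψ y) Ω (e.symm x) := by
  classical
  obtain ⟨ρ, hρ, hball⟩ := Metric.mem_nhds_iff.1
    (Filter.inter_mem (e.open_target.mem_nhds hx) hmax)
  let χ : ContDiffBump x := ⟨ρ / 4, ρ / 2, by positivity, by linarith⟩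
  have hout : Metric.closedBall x (ρ / 2) ⊆ Metric.ball x ρ :=
    Metric.closedBall_subset_ball (by linarith)
  set c : ℝ := w (e.symm x) - F x with hc
  -- A cutoff glues `F` to the constant `C - c`, where `c` is the contact value. Since `w ≤ C` on
  -- `Ω`, the constant keeps `w - ψ ≤ c` away from the chart.
  let ψ : M → ℝ := fun y => if y ∈ e.source then χ (e y) * F (e y) + (1 - χ (e y)) * (C - c)
    else C - c
  have hψs : ∀ y ∈ e.source, ψ y = χ (e y) * F (e y) + (1 - χ (e y)) * (C - c) :=
    fun y hy => if_pos hy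
  have hψn : ∀ y ∉ e.source, ψ y = C - c := fun y hy => if_neg hy
  have hχ0 : ∀ z, z ∉ Metric.ball x (ρ / 2) → χ z = 0 := fun z hz => by
    by_contra h
    exact hz (by
      have : z ∈ Function.support χ := h
      rwa [χ.support_eq] at this)
  have hnear : ψ ∘ e.symm =ᶠ[𝓝 x] F := by
    filter_upwards [Metric.ball_mem_nhds x (show 0 < ρ / 4 by positivity)] with z hz
    have hzt : z ∈ e.target := (hball (Metric.ball_subset_ball (by linarith) hz)).1
    have hz1 : χ z = 1 := χ.one_of_mem_closedBall (Metric.ball_subset_closedBall hz)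
    rw [Function.comp_apply, hψs _ (e.map_target hzt), e.right_inv hzt, hz1]
    ring
  refine ⟨ψ, ?_, hnear, ?_⟩
  · intro y
    by_cases hy : y ∈ e.source
    · have h1 : ContDiff ℝ 2 (fun z => χ z * F z + (1 - χ z) * (C - c)) := by
        have hχ : ContDiff ℝ 2 χ := χ.contDiff
        fun_prop
      have h2 : ContMDiffAt (𝓡 n) (𝓡 n) 2 e y :=
        (contMDiffAt_of_mem_maximalAtlas he hy).of_le ENat.LEInfty.out
      have h3 := (h1.contMDiff.contMDiffAt (x := e y)).comp y h2
      refine h3.congr_of_eventuallyEq ?_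
      filter_upwards [e.open_source.mem_nhds hy] with y' hy' using hψs y' hy'
    · set K : Set M := e.symm '' Metric.closedBall x (ρ / 2) with hK
      -- The Hausdorff property closes the compact support of the cutoff, so `ψ` is locally constant
      -- near points outside the chart.
      have hKc : IsClosed K := ((isCompact_closedBall x (ρ / 2)).image_of_continuousOn
        (e.continuousOn_symm.mono fun z hz => (hball (hout hz)).1)).isClosed
      have hyK : y ∉ K := by
        rintro ⟨z, hz, rfl⟩
        exact hy (e.map_target (hball (hout hz)).1)
      have h3 : ψ =ᶠ[𝓝 y] fun _ => C - c := by
        filter_upwards [hKc.isOpen_compl.mem_nhds hyK] with y' hy'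
        by_cases hs : y' ∈ e.source
        · have : χ (e y') = 0 := hχ0 _ fun hb =>
            hy' ⟨e y', Metric.ball_subset_closedBall hb, e.left_inv hs⟩
          rw [hψs _ hs, this]; ring
        · exact hψn _ hs
      exact contMDiffAt_const.congr_of_eventuallyEq h3
  · intro y hy
    have hxval : w (e.symm x) - ψ (e.symm x) = c := by
      have := hnear.self_of_nhds
      rw [Function.comp_apply] at this
      rw [this]
    change w y - ψ y ≤ w (e.symm x) - ψ (e.symm x)
    rw [hxval]
    have hCy := hC y hy
    by_cases hs : y ∈ e.source
    · rw [hψs y hs]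
      by_cases hb : e y ∈ Metric.ball x (ρ / 2)
      · have h1 : w (e.symm (e y)) - F (e y) ≤ w (e.symm x) - F x :=
          (hball (hout (Metric.ball_subset_closedBall hb))).2
        rw [e.left_inv hs, ← hc] at h1
        have h2 : 0 ≤ χ (e y) := χ.nonneg
        have h3 : χ (e y) ≤ 1 := χ.le_one
        nlinarith [mul_nonneg h2 (sub_nonneg.2 h1), mul_nonneg (sub_nonneg.2 h3) (sub_nonneg.2 hCy)]
      · rw [hχ0 _ hb]; linarith
    · rw [hψn y hs]; linarith

variable {X : Fin m → (x : M) → TangentSpace (𝓡 n) x}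
  {A : (Fin m → ℝ) → Matrix (Fin m) (Fin m) ℝ} {H : (Fin m → ℝ) → ℝ}

omit [ChartedSpace (EuclideanSpace ℝ (Fin n)) M] in
lemma contDiffAt_of_germ {ψ : M → ℝ} {F : EuclideanSpace ℝ (Fin n) → ℝ} (hF : ContDiff ℝ 2 F)
    {x : EuclideanSpace ℝ (Fin n)} (h : ψ ∘ e.symm =ᶠ[𝓝 x] F) :
    ContDiffAt ℝ 2 (ψ ∘ e.symm) x := hF.contDiffAt.congr_of_eventuallyEq h

lemma quasilinearOp_of_germ [IsManifold (𝓡 n) ∞ M]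
    (he : e ∈ IsManifold.maximalAtlas (𝓡 n) ∞ M)
    (hX : ∀ i, ContMDiff (𝓡 n) (𝓡 n).tangent ∞
      (fun x => (⟨x, X i x⟩ : TangentBundle (𝓡 n) M)))
    {ψ : M → ℝ} {F : EuclideanSpace ℝ (Fin n) → ℝ} (hF : ContDiff ℝ 2 F)
    {x : EuclideanSpace ℝ (Fin n)} (hx : x ∈ e.target) (h : ψ ∘ e.symm =ᶠ[𝓝 x] F) :
    quasilinearOp X A H ψ (e.symm x)
      = opFun A H (coordGrad (fun i => coordField e (X i)) x (fderiv ℝ F x))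
        (coordHess (fun i => coordField e (X i)) x (fderiv ℝ F x) (fderiv ℝ (fderiv ℝ F) x)) := by
  have h1 := contDiffAt_of_germ hF h
  rw [quasilinearOp, hgrad_symm_apply he X hx (h1.differentiableAt (by simp)),
    hhess_symm_apply he hX hx h1, h.fderiv_eq, h.fderiv.fderiv_eq]
  rfl

lemma mvfderiv_ne_zero_of_germ (he : e ∈ IsManifold.maximalAtlas (𝓡 n) ∞ M)
    {ψ : M → ℝ} {F : EuclideanSpace ℝ (Fin n) → ℝ} (hF : ContDiff ℝ 2 F)
    {x : EuclideanSpace ℝ (Fin n)} (hx : x ∈ e.target) (h : ψ ∘ e.symm =ᶠ[𝓝 x] F)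
    (hξ : coordGrad (fun i => coordField e (X i)) x (fderiv ℝ F x) ≠ 0) :
    mvfderiv (𝓡 n) ψ (e.symm x) ≠ 0 := by
  intro h0
  apply hξ
  have h1 := contDiffAt_of_germ hF h
  rw [← h.fderiv_eq, ← hgrad_symm_apply he X hx (h1.differentiableAt (by simp))]
  ext i
  simp [hgrad, along, h0]

lemma ViscositySub.le_of_isLocalMax [T2Space M] [IsManifold (𝓡 n) ∞ M]
    (he : e ∈ IsManifold.maximalAtlas (𝓡 n) ∞ M)
    (hX : ∀ i, ContMDiff (𝓡 n) (𝓡 n).tangent ∞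
      (fun x => (⟨x, X i x⟩ : TangentBundle (𝓡 n) M)))
    {Ω : Set M} {w : M → ℝ} {C : ℝ} (hC : ∀ y ∈ Ω, w y ≤ C) (hw : ViscositySub X A H Ω w)
    {x : EuclideanSpace ℝ (Fin n)} (hx : x ∈ e.target) (hxΩ : e.symm x ∈ Ω)
    {F : EuclideanSpace ℝ (Fin n) → ℝ} (hF : ContDiff ℝ 2 F)
    (hmax : IsLocalMax (fun y => w (e.symm y) - F y) x)
    (hξ : coordGrad (fun i => coordField e (X i)) x (fderiv ℝ F x) ≠ 0) :
    opFun A H (coordGrad (fun i => coordField e (X i)) x (fderiv ℝ F x))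
        (coordHess (fun i => coordField e (X i)) x (fderiv ℝ F x) (fderiv ℝ (fderiv ℝ F) x)) ≤ 0 := by
  obtain ⟨ψ, hψ, hg, hm⟩ := exists_global_test he hC hx hF hmax
  rw [← quasilinearOp_of_germ he hX hF hx hg]
  exact hw _ hxΩ ψ hψ.contMDiffOn hm (mvfderiv_ne_zero_of_germ he hF hx hg hξ)

lemma ViscositySuper.le_of_isLocalMin [T2Space M] [IsManifold (𝓡 n) ∞ M]
    (he : e ∈ IsManifold.maximalAtlas (𝓡 n) ∞ M)
    (hX : ∀ i, ContMDiff (𝓡 n) (𝓡 n).tangent ∞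
      (fun x => (⟨x, X i x⟩ : TangentBundle (𝓡 n) M)))
    {Ω : Set M} {w : M → ℝ} {C : ℝ} (hC : ∀ y ∈ Ω, C ≤ w y) (hw : ViscositySuper X A H Ω w)
    {x : EuclideanSpace ℝ (Fin n)} (hx : x ∈ e.target) (hxΩ : e.symm x ∈ Ω)
    {F : EuclideanSpace ℝ (Fin n) → ℝ} (hF : ContDiff ℝ 2 F)
    (hmin : IsLocalMin (fun y => w (e.symm y) - F y) x)
    (hξ : coordGrad (fun i => coordField e (X i)) x (fderiv ℝ F x) ≠ 0) :
    0 ≤ opFun A H (coordGrad (fun i => coordField e (X i)) x (fderiv ℝ F x))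
        (coordHess (fun i => coordField e (X i)) x (fderiv ℝ F x) (fderiv ℝ (fderiv ℝ F) x)) := by
  obtain ⟨ψ, hψ, hg, hm⟩ := exists_global_test he (w := fun y => -w y) (C := -C)
    (fun y hy => neg_le_neg (hC y hy)) hx hF.neg (by
      filter_upwards [hmin] with y hy
      linarith)
  have hg' : (fun y => -ψ y) ∘ e.symm =ᶠ[𝓝 x] F := by
    filter_upwards [hg] with y hy
    simp only [Function.comp_apply] at hy ⊢
    rw [hy]; simp
  rw [← quasilinearOp_of_germ he hX hF hx hg']
  refine hw _ hxΩ _ hψ.neg.contMDiffOn (fun y hy => ?_)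
    (mvfderiv_ne_zero_of_germ he hF hx hg' hξ)
  have := hm hy
  simp only [mem_ofPred_eq] at this ⊢
  linarith

end Coordinates

/-! ### Derivatives of the quadratic and exponential test functions -/

section Jets

variable {E : Type*} [NormedAddCommGroup E] [InnerProductSpace ℝ E]

/-- The inner product as a bilinear map. -/
noncomputable def realInner : E →L[ℝ] E →L[ℝ] ℝ := innerSL ℝ

lemma realInner_apply (x y : E) : realInner x y = ⟪x, y⟫ := rfl

/-- The symmetric bilinear form with the quadratic form of `S`. -/
noncomputable def hessForm (S : E →L[ℝ] E) : E →L[ℝ] E →L[ℝ] ℝ :=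
  (1 / 2 : ℝ) • (realInner.comp S + (realInner.comp S).flip)

lemma hessForm_apply (S : E →L[ℝ] E) (h k : E) :
    hessForm S h k = 1 / 2 * (⟪S h, k⟫ + ⟪S k, h⟫) := rfl

lemma hessForm_neg (S : E →L[ℝ] E) (h k : E) : hessForm (-S) h k = -hessForm S h k := by
  simp only [hessForm_apply, neg_apply, inner_neg_left]
  ring

lemma hasFDerivAt_quad (y q : E) (S : E →L[ℝ] E) (z : E) :
    HasFDerivAt (quad y q S) (realInner q + hessForm S (z - y)) z := by
  have h0 : HasFDerivAt (fun x : E => x - y) (ContinuousLinearMap.id ℝ E) z :=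
    (hasFDerivAt_id z).sub_const y
  have h1 : HasFDerivAt (fun x : E => ⟪q, x - y⟫) (realInner q) z :=
    ((realInner q).hasFDerivAt.comp z h0).congr_fderiv (by ext; rfl)
  have h2 := ((S.hasFDerivAt.comp z h0).inner ℝ h0).const_mul (1 / 2)
  refine (h1.add h2).congr_fderiv ?_
  ext v
  simp only [fderivInnerCLM_apply, add_apply, smul_apply, realInner_apply, hessForm_apply,
    ContinuousLinearMap.comp_apply, ContinuousLinearMap.prod_apply, ContinuousLinearMap.id_apply,
    smul_eq_mul, Function.comp_apply]

lemma fderiv_quad (y q : E) (S : E →L[ℝ] E) :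
    fderiv ℝ (quad y q S) = fun z => realInner q + hessForm S (z - y) :=
  funext fun z => (hasFDerivAt_quad y q S z).fderiv

lemma hasFDerivAt_fderiv_quad (y q : E) (S : E →L[ℝ] E) (z : E) :
    HasFDerivAt (fun z => realInner q + hessForm S (z - y)) (hessForm S) z := by
  have h := ((hessForm S).hasFDerivAt (x := z - y)).comp z ((hasFDerivAt_id z).sub_const y)
  exact (h.const_add (realInner q)).congr_fderiv (by ext; rfl)

lemma contDiff_quad (y q : E) (S : E →L[ℝ] E) : ContDiff ℝ 2 (quad y q S) := by
  unfold quad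
  exact (contDiff_const.inner ℝ (contDiff_id.sub contDiff_const)).add
    (contDiff_const.mul ((S.contDiff.comp (contDiff_id.sub contDiff_const)).inner ℝ
      (contDiff_id.sub contDiff_const)))

@[simp] lemma quad_self (y q : E) (S : E →L[ℝ] E) : quad y q S y = 0 := by simp [quad]

/-- The function `G(s) = (exp (ε (s + R)) - 1) / ε - R`, composed with `a - quad y p S`. -/
noncomputable def expQuad (ε R a : ℝ) (y p : E) (S : E →L[ℝ] E) (x : E) : ℝ :=
  (Real.exp (ε * (a - quad y p S x + R)) - 1) / ε - R

lemma contDiff_expQuad (ε R a : ℝ) (y p : E) (S : E →L[ℝ] E) :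
    ContDiff ℝ 2 (expQuad ε R a y p S) := by
  have := contDiff_quad y p S
  unfold expQuad
  fun_prop

lemma hasFDerivAt_exp_quad (ε R a : ℝ) (y p : E) (S : E →L[ℝ] E) (z : E) :
    HasFDerivAt (fun x => Real.exp (ε * (a - quad y p S x + R)))
      ((Real.exp (ε * (a - quad y p S z + R)) * ε) • -(realInner p + hessForm S (z - y))) z := by
  have h := ((((hasFDerivAt_quad y p S z).const_sub a).add_const R).const_mul ε).exp
  exact h.congr_fderiv (by rw [smul_smul])

lemma fderiv_expQuad {ε : ℝ} (hε : ε ≠ 0) (R a : ℝ) (y p : E) (S : E →L[ℝ] E) :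
    fderiv ℝ (expQuad ε R a y p S) = fun z =>
      Real.exp (ε * (a - quad y p S z + R)) • -(realInner p + hessForm S (z - y)) := by
  funext z
  have h := (((hasFDerivAt_exp_quad ε R a y p S z).sub_const 1).mul_const ε⁻¹).sub_const R
  refine HasFDerivAt.fderiv (h.congr_fderiv ?_)
  rw [smul_smul]
  congr 1
  field_simp

/-- The rank-one term comes from the convexity of the exponential; it is the source of strictness.
-/
lemma fderiv_fderiv_expQuad {ε : ℝ} (hε : ε ≠ 0) (R a : ℝ) (y p : E) (S : E →L[ℝ] E) (h k : E) :
    fderiv ℝ (fderiv ℝ (expQuad ε R a y p S)) y h k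
      = Real.exp (ε * (a + R)) * hessForm (-S) h k
        + (ε * Real.exp (ε * (a + R))) * (realInner (-p) h * realInner (-p) k) := by
  rw [fderiv_expQuad hε]
  have h1 := (hasFDerivAt_exp_quad ε R a y p S y).smul (hasFDerivAt_fderiv_quad y p S y).neg
  have h2 := h1.fderiv
  simp only [Pi.neg_apply, sub_self, map_zero, add_zero, quad_self, sub_zero] at h2
  have h3 : fderiv ℝ (fun z => Real.exp (ε * (a - quad y p S z + R)) •
      -(realInner p + hessForm S (z - y))) y = _ := h2
  rw [h3]
  simp [hessForm_neg]
  ring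

end Jets

/-! ### Strict monotonicity, ellipticity and continuity of the operator -/

section Operator

variable {m : ℕ} {A : (Fin m → ℝ) → Matrix (Fin m) (Fin m) ℝ} {H : (Fin m → ℝ) → ℝ}

/-- The scaling condition makes an increasing convex change of the unknown strictly monotone for
the operator. -/
lemma StructureConditions.strict (hAH : StructureConditions A H) {ξ : Fin m → ℝ} (hξ : ξ ≠ 0)
    {Y : Matrix (Fin m) (Fin m) ℝ} (hY : Y.IsSymm) {t ε : ℝ} (ht : 1 ≤ t)
    (h : 0 ≤ opFun A H (t • ξ) (t • Y + (ε * t) • Matrix.vecMulVec ξ ξ)) :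
    ε * ((A ξ).mulVec ξ ⬝ᵥ ξ) ≤ opFun A H ξ Y := by
  obtain ⟨φ, hφ, hs⟩ := hAH.scaling
  have ht0 : 0 < t := by linarith
  have hφ0 : 0 < φ (1 / t) := (hφ (1 / t) ⟨by positivity, by rw [div_le_one ht0]; exact ht⟩).1
  obtain ⟨h1, h2⟩ := hs t ht ξ hξ
  have hsymm : (t • Y + (ε * t) • Matrix.vecMulVec ξ ξ).IsSymm := by
    refine (hY.smul t).add (Matrix.IsSymm.smul ?_ _)
    rw [Matrix.IsSymm, Matrix.transpose_vecMulVec]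
  have h3 := h1 _ hsymm
  have htr : (A ξ * (t • Y + (ε * t) • Matrix.vecMulVec ξ ξ)).trace
      = t * ((A ξ * Y).trace + ε * ((A ξ).mulVec ξ ⬝ᵥ ξ)) := by
    rw [mul_add, Matrix.mul_smul, Matrix.mul_smul, Matrix.trace_add, Matrix.trace_smul,
      Matrix.trace_smul, Matrix.mul_vecMulVec, Matrix.trace_vecMulVec]
    simp only [smul_eq_mul]
    ring
  rw [htr] at h3
  rw [opFun] at h ⊢
  have h4 : 0 ≤ -(t * ((A ξ * Y).trace + ε * ((A ξ).mulVec ξ ⬝ᵥ ξ))) / (t * φ (1 / t))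
      + 1 / φ (1 / t) * H ξ := by linarith
  -- The factor `t` of the Hessian cancels the one in the scaling bound, leaving the common positive
  -- factor `1 / φ (1 / t)` on both terms.
  have h5 : -(t * ((A ξ * Y).trace + ε * ((A ξ).mulVec ξ ⬝ᵥ ξ))) / (t * φ (1 / t))
      + 1 / φ (1 / t) * H ξ
      = (-((A ξ * Y).trace + ε * ((A ξ).mulVec ξ ⬝ᵥ ξ)) + H ξ) / φ (1 / t) := by
    field_simp
  rw [h5] at h4
  have h6 := mul_nonneg h4 hφ0.le
  rw [div_mul_cancel₀ _ hφ0.ne'] at h6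
  linarith

/-- Degenerate ellipticity. -/
lemma StructureConditions.opFun_anti (hAH : StructureConditions A H) (ξ : Fin m → ℝ)
    {Y Z : Matrix (Fin m) (Fin m) ℝ}
    (hYZ : ∀ c : Fin m → ℝ, c ⬝ᵥ Y.mulVec c ≤ c ⬝ᵥ Z.mulVec c) :
    opFun A H ξ Z ≤ opFun A H ξ Y := by
  obtain ⟨k, c, hc⟩ := Matrix.posSemidef_iff_eq_sum_vecMulVec.1 (hAH.posSemidef ξ)
  have htr : ∀ W : Matrix (Fin m) (Fin m) ℝ,
      (A ξ * W).trace = ∑ i, c i ⬝ᵥ W.mulVec (c i) := by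
    intro W
    rw [hc, Finset.sum_mul, Matrix.trace_sum]
    refine Finset.sum_congr rfl fun i _ => ?_
    rw [Matrix.vecMulVec_mul, Matrix.trace_vecMulVec, star_trivial, dotProduct_comm,
      Matrix.dotProduct_mulVec]
  rw [opFun, opFun, htr, htr]
  have := Finset.sum_le_sum fun i (_ : i ∈ Finset.univ) => hYZ (c i)
  linarith

variable {E : Type*} [NormedAddCommGroup E] [InnerProductSpace ℝ E]

lemma coordHess_isSymm (s : Fin m → E → E) (x : E) (p : E →L[ℝ] ℝ) (B : E →L[ℝ] E →L[ℝ] ℝ) :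
    (coordHess s x p B).IsSymm := by
  ext i j
  simp only [coordHess, Matrix.transpose_apply, Matrix.of_apply]
  ring

/-- The operator on second order jets. -/
noncomputable def jetOp (s : Fin m → E → E) (A : (Fin m → ℝ) → Matrix (Fin m) (Fin m) ℝ)
    (H : (Fin m → ℝ) → ℝ) (j : E × E × (E →L[ℝ] E)) : ℝ :=
  opFun A H (coordGrad s j.1 (realInner j.2.1))
    (coordHess s j.1 (realInner j.2.1) (hessForm j.2.2))

lemma continuousAt_coordGrad {s : Fin m → E → E} {y q : E}
    (hs : ∀ i, ContDiffAt ℝ ∞ (s i) y) :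
    ContinuousAt (fun j : E × E => coordGrad s j.1 (realInner j.2)) (y, q) := by
  refine continuousAt_pi.2 fun i => ?_
  have h1 : ContinuousAt (fun j : E × E => s i j.1) (y, q) :=
    ContinuousAt.comp (f := Prod.fst) (hs i).continuousAt continuousAt_fst
  exact continuousAt_snd.inner h1

lemma continuousAt_jetOp (hAH : StructureConditions A H) {s : Fin m → E → E} {y q : E}
    {S : E →L[ℝ] E} (hs : ∀ i, ContDiffAt ℝ ∞ (s i) y) : ContinuousAt (jetOp s A H) (y, q, S) := by
  have hsc : ∀ i, ContinuousAt (fun j : E × E × (E →L[ℝ] E) => s i j.1) (y, q, S) := fun i =>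
    ContinuousAt.comp (f := Prod.fst) (hs i).continuousAt continuousAt_fst
  have hds : ∀ i, ContinuousAt (fun j : E × E × (E →L[ℝ] E) => fderiv ℝ (s i) j.1) (y, q, S) :=
    fun i => ContinuousAt.comp (f := Prod.fst)
      ((hs i).fderiv_right (m := 0) (by simp)).continuousAt continuousAt_fst
  have hq : ContinuousAt (fun j : E × E × (E →L[ℝ] E) => j.2.1) (y, q, S) := by fun_prop
  have hS : ContinuousAt (fun j : E × E × (E →L[ℝ] E) => j.2.2) (y, q, S) := by fun_prop
  have hξ : ContinuousAt (fun j : E × E × (E →L[ℝ] E) => coordGrad s j.1 (realInner j.2.1))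
      (y, q, S) := continuousAt_pi.2 fun i => hq.inner (hsc i)
  have hY : ContinuousAt (fun j : E × E × (E →L[ℝ] E) =>
      coordHess s j.1 (realInner j.2.1) (hessForm j.2.2)) (y, q, S) := by
    refine continuousAt_pi.2 fun i => continuousAt_pi.2 fun k => ?_
    have h1 : ∀ i k, ContinuousAt (fun j : E × E × (E →L[ℝ] E) => ⟪j.2.2 (s i j.1), s k j.1⟫)
        (y, q, S) := fun i k => (hS.clm_apply (hsc i)).inner (hsc k)
    have h2 : ∀ i k, ContinuousAt (fun j : E × E × (E →L[ℝ] E) =>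
        ⟪j.2.1, fderiv ℝ (s k) j.1 (s i j.1)⟫) (y, q, S) := fun i k =>
      hq.inner ((hds k).clm_apply (hsc i))
    exact ((((continuousAt_const.mul ((h1 i k).add (h1 k i)))).add (h2 i k)).add
      (((continuousAt_const.mul ((h1 k i).add (h1 i k)))).add (h2 k i))).div_const 2
  have hc : Continuous fun z : (Fin m → ℝ) × Matrix (Fin m) (Fin m) ℝ => opFun A H z.1 z.2 := by
    unfold opFun
    have h1 := hAH.continuous_A
    have h2 := hAH.continuous_H
    exact ((h1.comp continuous_fst).mul continuous_snd).matrix_trace.neg.add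
      (h2.comp continuous_fst)
  exact ContinuousAt.comp (f := fun j : E × E × (E →L[ℝ] E) =>
    (coordGrad s j.1 (realInner j.2.1), coordHess s j.1 (realInner j.2.1) (hessForm j.2.2)))
    hc.continuousAt (hξ.prodMk hY)

/-- The first order terms of the two horizontal Hessians agree, so on a vector `c` they differ by
the quadratic form of `T - S` at `∑ c i • s i y`. -/
lemma jetOp_anti (hAH : StructureConditions A H) (s : Fin m → E → E) (y q : E) {S T : E →L[ℝ] E}
    (hST : ∀ x, ⟪S x, x⟫ ≤ ⟪T x, x⟫) : jetOp s A H (y, q, T) ≤ jetOp s A H (y, q, S) := by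
  refine hAH.opFun_anti _ fun c => ?_
  have key : c ⬝ᵥ (coordHess s y (realInner q) (hessForm T)).mulVec c
      - c ⬝ᵥ (coordHess s y (realInner q) (hessForm S)).mulVec c
      = ⟪(T - S) (∑ i, c i • s i y), ∑ i, c i • s i y⟫ := by
    rw [← dotProduct_sub, ← Matrix.sub_mulVec, map_sum, sum_inner]
    simp only [dotProduct, Matrix.mulVec, Finset.mul_sum, inner_sum, map_smul, inner_smul_left,
      inner_smul_right, conj_trivial]
    have hsym : ∑ i, ∑ j, c j * (c i * ⟪(T - S) (s i y), s j y⟫)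
        = ∑ i, ∑ j, c j * (c i * ⟪(T - S) (s j y), s i y⟫) := by
      rw [Finset.sum_comm]
      exact Finset.sum_congr rfl fun i _ => Finset.sum_congr rfl fun j _ => by ring
    have : ∀ a b : ℝ, a = b → a = 1 / 2 * (a + b) := fun a b h => by linarith
    rw [show (∑ i, ∑ j, c j * (c i * ⟪(T - S) (s i y), s j y⟫)) = _ from this _ _ hsym,
      ← Finset.sum_add_distrib, Finset.mul_sum]
    refine Finset.sum_congr rfl fun i _ => ?_
    rw [← Finset.sum_add_distrib, Finset.mul_sum]
    refine Finset.sum_congr rfl fun j _ => ?_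
    simp only [coordHess, Matrix.sub_apply, Matrix.of_apply, hessForm_apply, sub_apply,
      inner_sub_left]
    ring
  have h := hST (∑ i, c i • s i y)
  rw [sub_apply, inner_sub_left] at key
  linarith

end Operator

/-! ### The concave change of unknown -/

section ChangeOfUnknown

/-- The concave change of unknown `F(s) = log (1 + ε (s + R)) / ε - R`. -/
noncomputable def logChange (ε R s : ℝ) : ℝ := Real.log (1 + ε * (s + R)) / ε - R

variable {ε R : ℝ}

lemma one_le_one_add_mul (hε : 0 < ε) {s : ℝ} (hs : -R ≤ s) : 1 ≤ 1 + ε * (s + R) := by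
  have : 0 ≤ ε * (s + R) := mul_nonneg hε.le (by linarith)
  linarith

lemma exp_logChange (hε : 0 < ε) {s : ℝ} (hs : -R ≤ s) :
    (Real.exp (ε * (logChange ε R s + R)) - 1) / ε - R = s := by
  have h1 := one_le_one_add_mul hε hs
  have h2 : ε * (logChange ε R s + R) = Real.log (1 + ε * (s + R)) := by
    rw [logChange]; field_simp; ring
  rw [h2, Real.exp_log (by linarith)]
  field_simp
  ring

lemma neg_le_logChange (hε : 0 < ε) {s : ℝ} (hs : -R ≤ s) : -R ≤ logChange ε R s := by
  have := div_nonneg (Real.log_nonneg (one_le_one_add_mul hε hs)) hε.le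
  rw [logChange]; linarith

lemma logChange_le (hε : 0 < ε) {s : ℝ} (hs : -R ≤ s) : logChange ε R s ≤ s := by
  have h1 := Real.log_le_sub_one_of_pos (zero_lt_one.trans_le (one_le_one_add_mul hε hs))
  have h2 : Real.log (1 + ε * (s + R)) / ε ≤ s + R := by
    rw [div_le_iff₀ hε]; linarith
  rw [logChange]; linarith

/-- From `log (1 + x) ≥ x / (1 + x) ≥ x - x ^ 2`. With `logChange_le` this gives uniform convergence
to the identity on bounded sets. -/
lemma sub_le_logChange (hε : 0 < ε) {s : ℝ} (hs : -R ≤ s) :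
    s - ε * (s + R) ^ 2 ≤ logChange ε R s := by
  have h0 := one_le_one_add_mul hε hs
  have h1 := Real.one_sub_inv_le_log_of_pos (zero_lt_one.trans_le h0)
  have hx : 0 ≤ ε * (s + R) := by linarith
  have h2 : ε * (s + R) - (ε * (s + R)) ^ 2 ≤ 1 - (1 + ε * (s + R))⁻¹ := by
    rw [← sub_nonneg]
    have : 1 - (1 + ε * (s + R))⁻¹ - (ε * (s + R) - (ε * (s + R)) ^ 2)
        = (ε * (s + R)) ^ 3 / (1 + ε * (s + R)) := by field_simp; ring
    rw [this]
    positivity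
  have h3 : s + R - ε * (s + R) ^ 2 ≤ Real.log (1 + ε * (s + R)) / ε := by
    rw [le_div_iff₀ hε]; linarith
  rw [logChange]; linarith

lemma logChange_mono (hε : 0 < ε) {s t : ℝ} (hs : -R ≤ s) (hst : s ≤ t) :
    logChange ε R s ≤ logChange ε R t := by
  have h0 := one_le_one_add_mul hε hs
  unfold logChange
  gcongr

lemma logChange_sub_le (hε : 0 < ε) {s t : ℝ} (ht : -R ≤ t) (hst : t ≤ s) :
    logChange ε R s - logChange ε R t ≤ s - t := by
  have hs : -R ≤ s := ht.trans hst
  have h0 := one_le_one_add_mul hε ht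
  have h1 := one_le_one_add_mul hε hs
  have h2 := Real.log_le_sub_one_of_pos
    (show 0 < (1 + ε * (s + R)) / (1 + ε * (t + R)) by positivity)
  rw [Real.log_div (by positivity) (by positivity)] at h2
  have h3 : (1 + ε * (s + R)) / (1 + ε * (t + R)) - 1 ≤ ε * (s - t) := by
    have : (1 + ε * (s + R)) / (1 + ε * (t + R)) - 1 = ε * (s - t) / (1 + ε * (t + R)) := by
      field_simp; ring
    rw [this]
    exact div_le_self (mul_nonneg hε.le (by linarith)) h0
  have h4 : logChange ε R s - logChange ε R t
      = (Real.log (1 + ε * (s + R)) - Real.log (1 + ε * (t + R))) / ε := by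
    rw [logChange, logChange]; ring
  rw [h4, div_le_iff₀ hε]
  linarith

lemma logChange_concave (hε : 0 < ε) {s t a b : ℝ} (hs : -R ≤ s) (ht : -R ≤ t) (ha : 0 ≤ a)
    (hb : 0 ≤ b) (hab : a + b = 1) :
    a * logChange ε R s + b * logChange ε R t ≤ logChange ε R (a * s + b * t) := by
  have h0 := one_le_one_add_mul hε hs
  have h1 := one_le_one_add_mul hε ht
  have h2 := strictConcaveOn_log_Ioi.concaveOn.2 (mem_Ioi.2 (zero_lt_one.trans_le h0))
    (mem_Ioi.2 (zero_lt_one.trans_le h1)) ha hb hab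
  simp only [smul_eq_mul] at h2
  have h3 : a * (1 + ε * (s + R)) + b * (1 + ε * (t + R)) = 1 + ε * (a * s + b * t + R) := by
    linear_combination (1 + ε * R) * hab
  rw [h3] at h2
  have h4 : a * logChange ε R s + b * logChange ε R t
      = (a * Real.log (1 + ε * (s + R)) + b * Real.log (1 + ε * (t + R))) / ε - R := by
    rw [logChange, logChange]
    linear_combination (-R) * hab
  rw [h4, logChange]
  gcongr

/-- A concave, nondecreasing, 1-Lipschitz change of unknown preserves semiconcavity with the same
constant, hence uniformly in `ε`. -/
lemma strongConvexOn_neg_logChange {E : Type*} [NormedAddCommGroup E] [NormedSpace ℝ E]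
    {U : Set E} {v : E → ℝ} {Λ : ℝ} (hε : 0 < ε) (hΛ : 0 ≤ Λ) (hvR : ∀ x ∈ U, -R ≤ v x)
    (hv : StrongConvexOn U (-Λ) (fun x => -v x)) :
    StrongConvexOn U (-Λ) (fun x => -logChange ε R (v x)) := by
  refine ⟨hv.1, fun x hx y hy a b ha hb hab => ?_⟩
  have h1 := hv.2 hx hy ha hb hab
  have h2 := hvR _ (hv.1 hx hy ha hb hab)
  have h3 := logChange_concave hε (hvR x hx) (hvR y hy) ha hb hab
  have hxy : -R ≤ a * v x + b * v y := by
    have := hvR x hx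
    have := hvR y hy
    calc -R = a * -R + b * -R := by linear_combination R * hab
      _ ≤ _ := by gcongr
  simp only [smul_eq_mul] at h1 ⊢
  have h0 : 0 ≤ a * b * (Λ / 2 * ‖x - y‖ ^ 2) := by positivity
  -- Above the chord monotonicity suffices; below it the 1-Lipschitz bound loses at most the
  -- semiconcavity defect.
  rcases le_total (a * v x + b * v y) (v (a • x + b • y)) with h | h
  · have := logChange_mono hε hxy h
    linarith
  · have := logChange_sub_le hε h2 h
    linarith

end ChangeOfUnknown

/-! ### Differentiability at points of two-sided quadratic contact -/

section Contact

variable {E : Type*} [NormedAddCommGroup E] [InnerProductSpace ℝ E]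

lemma hasFDerivAt_of_contact {x q : E} {r Λ : ℝ} {u : E → ℝ} (hr : 0 < r)
    (hlow : SubgradAt (Metric.ball x r) Λ u x q)
    (hup : ∀ y ∈ Metric.ball x r, u y ≤ u x + ⟪q, y - x⟫ + Λ / 2 * ‖y - x‖ ^ 2) :
    HasFDerivAt u (realInner q) x := by
  refine .of_isLittleO (Asymptotics.IsBigO.trans_isLittleO (g := fun z' => ‖z' - x‖ ^ 2) ?_
    (Asymptotics.isLittleO_pow_sub_sub x one_lt_two))
  refine Asymptotics.IsBigO.of_bound (Λ / 2) ?_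
  filter_upwards [Metric.ball_mem_nhds x hr] with y hy
  have h1 := hlow y hy
  have h2 := hup y hy
  rw [Real.norm_eq_abs, Real.norm_of_nonneg (by positivity), abs_le, realInner_apply]
  constructor <;> linarith

lemma contact_upper {x q : E} {K : Set E} {Λ : ℝ} {u₁ u₂ : E → ℝ}
    (hq₂ : SubgradAt K Λ u₂ x (-q)) (hmax : ∀ y ∈ K, u₁ y + u₂ y ≤ u₁ x + u₂ x) :
    ∀ y ∈ K, u₁ y ≤ u₁ x + ⟪q, y - x⟫ + Λ / 2 * ‖y - x‖ ^ 2 := by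
  intro y hy
  have h1 := hq₂ y hy
  have h2 := hmax y hy
  rw [inner_neg_left] at h1
  linarith

/-- Subgradients near a point of differentiability with `C^{1,1}` contact are close to the
gradient. -/
lemma norm_sub_le_of_contact {x₀ q₀ : E} {r Λ s : ℝ} {u : E → ℝ} (hΛ : 0 < Λ)
    (hlow : SubgradAt (Metric.ball x₀ r) Λ u x₀ q₀)
    (hup : ∀ y ∈ Metric.ball x₀ r, u y ≤ u x₀ + ⟪q₀, y - x₀⟫ + Λ / 2 * ‖y - x₀‖ ^ 2)
    {y p : E} (hs : 0 < s) (hys : ‖y - x₀‖ ≤ s) (hsr : 2 * s < r)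
    (hp : SubgradAt (Metric.ball x₀ r) Λ u y p) : ‖p - q₀‖ ≤ 3 * Λ * s := by
  have h1 := hlow.sub_inner q₀
  rw [sub_self] at h1
  refine h1.norm_le_of_contact hΛ (fun z hz => ?_) hs hys hsr (hp.sub_inner q₀)
  have := hup z hz
  rw [inner_sub_right] at this
  linarith

end Contact

/-- Only jets near `j` need satisfy the inequality: the viscosity tests apply just where the
horizontal gradient is nonzero, an open condition. -/
lemma le_of_mem_closure_of_eventually {Z : Type*} [TopologicalSpace Z] {J : Set Z} {f : Z → ℝ}
    {j : Z} {c : ℝ} (hj : j ∈ closure J) (hf : ContinuousAt f j)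
    (h : ∀ᶠ i in 𝓝 j, i ∈ J → f i ≤ c) : f j ≤ c := by
  by_contra! hlt
  obtain ⟨i, hiJ, hi, hic⟩ := ((mem_closure_iff_frequently.1 hj).and_eventually
    (h.and (hf.eventually_const_lt hlt))).exists
  exact absurd (hi hiJ) (not_le.2 hic)

/-! ### Viscosity inequalities on jets and on their closure -/

section Viscosity

variable {n m : ℕ} {M : Type*} [TopologicalSpace M] [ChartedSpace (EuclideanSpace ℝ (Fin n)) M]
  [T2Space M] [IsManifold (𝓡 n) ∞ M]
  {e : OpenPartialHomeomorph M (EuclideanSpace ℝ (Fin n))}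
  {X : Fin m → (x : M) → TangentSpace (𝓡 n) x}
  {A : (Fin m → ℝ) → Matrix (Fin m) (Fin m) ℝ} {H : (Fin m → ℝ) → ℝ} {Ω : Set M}

lemma ViscositySub.jetOp_le (he : e ∈ IsManifold.maximalAtlas (𝓡 n) ∞ M)
    (hX : ∀ i, ContMDiff (𝓡 n) (𝓡 n).tangent ∞
      (fun x => (⟨x, X i x⟩ : TangentBundle (𝓡 n) M)))
    {u : M → ℝ} {C : ℝ} (hC : ∀ y ∈ Ω, u y ≤ C) (hu : ViscositySub X A H Ω u)
    {x q : EuclideanSpace ℝ (Fin n)} {S : EuclideanSpace ℝ (Fin n) →L[ℝ] EuclideanSpace ℝ (Fin n)}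
    (hx : x ∈ e.target) (hxΩ : e.symm x ∈ Ω) (hj : (x, q, S) ∈ superjet (fun z => u (e.symm z)))
    (hξ : coordGrad (fun i => coordField e (X i)) x (realInner q) ≠ 0) :
    jetOp (fun i => coordField e (X i)) A H (x, q, S) ≤ 0 := by
  have h1 : fderiv ℝ (quad x q S) x = realInner q := by
    rw [fderiv_quad]; simp
  have h2 : fderiv ℝ (fderiv ℝ (quad x q S)) x = hessForm S := by
    rw [fderiv_quad]; exact (hasFDerivAt_fderiv_quad x q S x).fderiv
  have := hu.le_of_isLocalMax he hX hC hx hxΩ (contDiff_quad x q S) hj (by rwa [h1])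
  rwa [h1, h2] at this

/-- A superjet of `-F(v)` is a quadratic touching `F(v)` from below; composed with `G` it touches
`v` from below, and the scaling condition turns its inequality into a strict one. -/
lemma ViscositySuper.le_jetOp (hAH : StructureConditions A H)
    (he : e ∈ IsManifold.maximalAtlas (𝓡 n) ∞ M)
    (hX : ∀ i, ContMDiff (𝓡 n) (𝓡 n).tangent ∞
      (fun x => (⟨x, X i x⟩ : TangentBundle (𝓡 n) M)))
    {v : M → ℝ} {ε R : ℝ} (hε : 0 < ε) (hΩ : IsOpen Ω) (hR : ∀ y ∈ Ω, -R ≤ v y)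
    (hv : ViscositySuper X A H Ω v)
    {x p : EuclideanSpace ℝ (Fin n)} {S : EuclideanSpace ℝ (Fin n) →L[ℝ] EuclideanSpace ℝ (Fin n)}
    (hx : x ∈ e.target) (hxΩ : e.symm x ∈ Ω)
    (hj : (x, p, S) ∈ superjet (fun z => -logChange ε R (v (e.symm z))))
    (hξ : coordGrad (fun i => coordField e (X i)) x (realInner (-p)) ≠ 0) :
    ε * ((A (coordGrad (fun i => coordField e (X i)) x (realInner (-p)))).mulVec
        (coordGrad (fun i => coordField e (X i)) x (realInner (-p))) ⬝ᵥ
        (coordGrad (fun i => coordField e (X i)) x (realInner (-p))))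
      ≤ jetOp (fun i => coordField e (X i)) A H (x, -p, -S) := by
  set s : Fin m → EuclideanSpace ℝ (Fin n) → EuclideanSpace ℝ (Fin n) :=
    fun i => coordField e (X i) with hs
  set ξ := coordGrad s x (realInner (-p)) with hξdef
  set a : ℝ := logChange ε R (v (e.symm x)) with ha
  set t : ℝ := Real.exp (ε * (a + R)) with ht
  have ht1 : 1 ≤ t := by
    refine Real.one_le_exp (mul_nonneg hε.le ?_)
    linarith [neg_le_logChange hε (hR _ hxΩ)]
  set F := expQuad ε R a x p S with hF
  have h1 : fderiv ℝ F x = t • realInner (-p) := by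
    rw [hF, fderiv_expQuad hε.ne']
    simp [ht]
  have hg : coordGrad s x (fderiv ℝ F x) = t • ξ := by
    rw [h1]; rfl
  have hB : coordHess s x (fderiv ℝ F x) (fderiv ℝ (fderiv ℝ F) x)
      = t • coordHess s x (realInner (-p)) (hessForm (-S)) + (ε * t) • Matrix.vecMulVec ξ ξ := by
    ext i j
    simp only [coordHess, Matrix.of_apply, Matrix.add_apply, Matrix.smul_apply, smul_eq_mul,
      Matrix.vecMulVec_apply]
    rw [h1, hF, fderiv_fderiv_expQuad hε.ne', fderiv_fderiv_expQuad hε.ne', ← ht]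
    simp only [hξdef, coordGrad, smul_apply, smul_eq_mul]
    ring
  have hmin : IsLocalMin (fun z => v (e.symm z) - F z) x := by
    have hΩe : ∀ᶠ z in 𝓝 x, e.symm z ∈ Ω :=
      (e.continuousAt_symm hx).eventually_mem (hΩ.mem_nhds hxΩ)
    have hj' : IsLocalMax (fun z => -logChange ε R (v (e.symm z)) - quad x p S z) x := hj
    filter_upwards [hΩe, hj'] with z hz hjz
    rw [quad_self] at hjz
    have e1 := exp_logChange hε (hR _ hxΩ)
    have e2 := exp_logChange hε (hR _ hz)
    have e3 : F x = v (e.symm x) := by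
      rw [hF, expQuad, quad_self, sub_zero, ha, e1]
    have e4 : F z ≤ v (e.symm z) := by
      rw [← e2, hF, expQuad]
      have : a - quad x p S z ≤ logChange ε R (v (e.symm z)) := by linarith
      gcongr
    rw [e3]
    linarith
  have h0 := hv.le_of_isLocalMin he hX hR hx hxΩ (contDiff_expQuad ε R a x p S) hmin (by
    change coordGrad s x (fderiv ℝ F x) ≠ 0
    rw [hg]
    exact smul_ne_zero (by linarith) hξ)
  change 0 ≤ opFun A H (coordGrad s x (fderiv ℝ F x))
    (coordHess s x (fderiv ℝ F x) (fderiv ℝ (fderiv ℝ F) x)) at h0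
  rw [hg, hB] at h0
  exact hAH.strict hξ (coordHess_isSymm _ _ _ _) ht1 h0

/-- There is no maximum of `u - F(v)` with nonvanishing horizontal gradient, for a subsolution `u`
and a supersolution `v`, at which `u` is semiconvex and `F(v)` is semiconcave. -/
lemma not_isMax_of_coordGrad_ne_zero (hAH : StructureConditions A H)
    (he : e ∈ IsManifold.maximalAtlas (𝓡 n) ∞ M)
    (hX : ∀ i, ContMDiff (𝓡 n) (𝓡 n).tangent ∞
      (fun x => (⟨x, X i x⟩ : TangentBundle (𝓡 n) M)))
    {u v : M → ℝ} {ε R C r Λ : ℝ} (hε : 0 < ε) (hΩ : IsOpen Ω) (hC : ∀ y ∈ Ω, u y ≤ C)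
    (hR : ∀ y ∈ Ω, -R ≤ v y) (hu : ViscositySub X A H Ω u) (hv : ViscositySuper X A H Ω v)
    {x q : EuclideanSpace ℝ (Fin n)} (hr : 0 < r) (hΛ : 0 < Λ)
    (hball : Metric.ball x r ⊆ e.target ∩ e.symm ⁻¹' Ω)
    (hsu : StrongConvexOn (Metric.ball x r) (-Λ) (fun z => u (e.symm z)))
    (hsv : StrongConvexOn (Metric.ball x r) (-Λ) (fun z => -logChange ε R (v (e.symm z))))
    (hq₁ : SubgradAt (Metric.ball x r) Λ (fun z => u (e.symm z)) x q)
    (hq₂ : SubgradAt (Metric.ball x r) Λ (fun z => -logChange ε R (v (e.symm z))) x (-q))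
    (hmax : ∀ y ∈ Metric.ball x r, u (e.symm y) + -logChange ε R (v (e.symm y))
      ≤ u (e.symm x) + -logChange ε R (v (e.symm x))) :
    coordGrad (fun i => coordField e (X i)) x (realInner q) = 0 := by
  by_contra hξ
  obtain ⟨S₁, S₂, hS, hj₁, hj₂⟩ := exists_superjets_closure hr hΛ hsu hsv hq₁ hq₂ hmax
  set s : Fin m → EuclideanSpace ℝ (Fin n) → EuclideanSpace ℝ (Fin n) :=
    fun i => coordField e (X i) with hs
  have hsx : ∀ i, ContDiffAt ℝ ∞ (s i) x := fun i =>
    contDiffAt_coordField he (hX i) (hball (Metric.mem_ball_self hr)).1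
  have hball' : ∀ j : EuclideanSpace ℝ (Fin n) ×
      (EuclideanSpace ℝ (Fin n) →L[ℝ] EuclideanSpace ℝ (Fin n)),
      ∀ᶠ i in 𝓝 (x, j), i.1 ∈ Metric.ball x r := fun j =>
    continuousAt_fst.eventually_mem (Metric.ball_mem_nhds x hr)
  have hg₁ : ContinuousAt (fun j : EuclideanSpace ℝ (Fin n) × EuclideanSpace ℝ (Fin n) ×
      (EuclideanSpace ℝ (Fin n) →L[ℝ] EuclideanSpace ℝ (Fin n)) =>
      coordGrad s j.1 (realInner j.2.1)) (x, q, S₁) :=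
    ContinuousAt.comp (f := fun j : EuclideanSpace ℝ (Fin n) × EuclideanSpace ℝ (Fin n) ×
      (EuclideanSpace ℝ (Fin n) →L[ℝ] EuclideanSpace ℝ (Fin n)) => (j.1, j.2.1))
      (continuousAt_coordGrad hsx) (by fun_prop)
  have hg₂ : ContinuousAt (fun j : EuclideanSpace ℝ (Fin n) × EuclideanSpace ℝ (Fin n) ×
      (EuclideanSpace ℝ (Fin n) →L[ℝ] EuclideanSpace ℝ (Fin n)) =>
      coordGrad s j.1 (realInner (-j.2.1))) (x, -q, S₂) := by
    refine ContinuousAt.comp (f := fun j : EuclideanSpace ℝ (Fin n) × EuclideanSpace ℝ (Fin n) ×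
      (EuclideanSpace ℝ (Fin n) →L[ℝ] EuclideanSpace ℝ (Fin n)) => (j.1, -j.2.1))
      (g := fun j => coordGrad s j.1 (realInner j.2)) ?_ (by fun_prop)
    simp only [neg_neg]
    exact continuousAt_coordGrad hsx
  have hle : jetOp s A H (x, q, S₁) ≤ 0 := by
    refine le_of_mem_closure_of_eventually hj₁ (continuousAt_jetOp hAH hsx) ?_
    filter_upwards [hball' (q, S₁), hg₁.eventually_ne hξ] with j hjb hjξ hjJ
    exact hu.jetOp_le he hX hC (hball hjb).1 (hball hjb).2 hjJ hjξ
  set f : EuclideanSpace ℝ (Fin n) × EuclideanSpace ℝ (Fin n) ×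
      (EuclideanSpace ℝ (Fin n) →L[ℝ] EuclideanSpace ℝ (Fin n)) → ℝ := fun j =>
    ε * ((A (coordGrad s j.1 (realInner (-j.2.1)))).mulVec (coordGrad s j.1 (realInner (-j.2.1)))
      ⬝ᵥ (coordGrad s j.1 (realInner (-j.2.1)))) - jetOp s A H (j.1, -j.2.1, -j.2.2) with hf
  have hfc : ContinuousAt f (x, -q, S₂) := by
    have h1 : Continuous fun ξ : Fin m → ℝ => ε * ((A ξ).mulVec ξ ⬝ᵥ ξ) := by
      have := hAH.continuous_A
      exact continuous_const.mul ((this.matrix_mulVec continuous_id).dotProduct continuous_id)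
    refine (ContinuousAt.comp (f := fun j : EuclideanSpace ℝ (Fin n) × EuclideanSpace ℝ (Fin n) ×
      (EuclideanSpace ℝ (Fin n) →L[ℝ] EuclideanSpace ℝ (Fin n)) =>
      coordGrad s j.1 (realInner (-j.2.1))) h1.continuousAt hg₂).sub ?_
    exact ContinuousAt.comp (f := fun j : EuclideanSpace ℝ (Fin n) × EuclideanSpace ℝ (Fin n) ×
      (EuclideanSpace ℝ (Fin n) →L[ℝ] EuclideanSpace ℝ (Fin n)) => (j.1, -j.2.1, -j.2.2))
      (continuousAt_jetOp hAH hsx) (by fun_prop)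
  have hge : f (x, -q, S₂) ≤ 0 := by
    refine le_of_mem_closure_of_eventually hj₂ hfc ?_
    have hξ' : coordGrad s x (realInner (- -q)) ≠ 0 := by rwa [neg_neg]
    filter_upwards [hball' (-q, S₂), hg₂.eventually_ne hξ'] with j hjb hjξ hjJ
    have := hv.le_jetOp hAH he hX hε hΩ hR (hball hjb).1 (hball hjb).2 hjJ hjξ
    exact sub_nonpos.2 this
  simp only [hf, neg_neg] at hge
  have hpos := mul_pos hε (hAH.elliptic _ hξ)
  -- The chain `0 < ε ⟨A(ξ) ξ, ξ⟩ ≤ L(q, -S₂) ≤ L(q, S₁) ≤ 0` is the contradiction.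
  have hanti := jetOp_anti hAH s x q (S := S₁) (T := -S₂) fun y => by
    rw [neg_apply, inner_neg_left]
    linarith [hS y]
  linarith

end Viscosity

/-! ### Maxima of the perturbed difference and the comparison -/

lemma SemiconvexNear.strongConvexOn {n : ℕ} {M : Type*} [TopologicalSpace M]
    {e : OpenPartialHomeomorph M (EuclideanSpace ℝ (Fin n))} {Ω : Set M} {w : M → ℝ} {y : M}
    (h : SemiconvexNear e Ω w y) :
    ∃ r > 0, ∃ Λ > 0, Metric.ball (e y) r ⊆ e.target ∩ e.symm ⁻¹' Ω ∧
      ∀ r' ≤ r, ∀ Λ' ≥ Λ, StrongConvexOn (Metric.ball (e y) r') (-Λ') (fun x => w (e.symm x)) := by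
  obtain ⟨r, hr, hball, Λ, hΛ, hc⟩ := h
  refine ⟨r, hr, Λ, hΛ, hball, fun r' hr' Λ' hΛ' => ?_⟩
  have h1 : StrongConvexOn (Metric.ball (e y) r) (-Λ) (fun x => w (e.symm x)) := by
    rw [strongConvexOn_iff_convex]
    convert! hc using 2
    ring
  have h2 := h1.mono (neg_le_neg hΛ')
  have hsub := Metric.ball_subset_ball (x := e y) hr'
  exact ⟨convex_ball _ _, fun x hx z hz => h2.2 (hsub hx) (hsub hz)⟩

lemma continuousOn_logChange {ε R : ℝ} (hε : 0 < ε) : ContinuousOn (logChange ε R) (Ici (-R)) := by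
  unfold logChange
  refine ((ContinuousOn.log (by fun_prop) fun s hs => ?_).div_const _).sub continuousOn_const
  exact (zero_lt_one.trans_le (one_le_one_add_mul hε hs)).ne'

/-- The maxima of `u - F(v)` accumulate at a maximum of `u - v` as `F` approaches the identity. -/
lemma exists_tendsto_isMaxOn_logChange {Y : Type*} [TopologicalSpace Y] [FirstCountableTopology Y]
    {K : Set Y} (hK : IsCompact K) (hne : K.Nonempty) {u v : Y → ℝ} (hu : ContinuousOn u K)
    (hv : ContinuousOn v K) {R : ℝ} (hR : ∀ y ∈ K, |v y| ≤ R) :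
    ∃ x ∈ K, IsMaxOn (fun y => u y - v y) K x ∧ ∃ (z : ℕ → Y) (ε : ℕ → ℝ),
      Filter.Tendsto z Filter.atTop (𝓝 x) ∧ ∀ k, 0 < ε k ∧ z k ∈ K ∧
        ∀ y ∈ K, u y + -logChange (ε k) R (v y) ≤ u (z k) + -logChange (ε k) R (v (z k)) := by
  have hR' : ∀ y ∈ K, -R ≤ v y := fun y hy => (abs_le.1 (hR y hy)).1
  set ε : ℕ → ℝ := fun k => 1 / ((k : ℝ) + 1) with hε
  have hε0 : ∀ k, 0 < ε k := fun k => Nat.one_div_pos_of_nat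
  have hz : ∀ k, ∃ z ∈ K, ∀ y ∈ K,
      u y + -logChange (ε k) R (v y) ≤ u z + -logChange (ε k) R (v z) := fun k =>
    hK.exists_isMaxOn hne (hu.add ((continuousOn_logChange (hε0 k)).comp hv hR').neg)
  choose z hzK hzmax using hz
  obtain ⟨x, hx, ψ, hψ, hlim⟩ := hK.tendsto_subseq hzK
  refine ⟨x, hx, fun y hy => ?_, z ∘ ψ, ε ∘ ψ, hlim, fun k => ⟨hε0 _, hzK _, hzmax _⟩⟩
  have hlimK : Filter.Tendsto (z ∘ ψ) Filter.atTop (𝓝[K] x) :=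
    tendsto_nhdsWithin_iff.2 ⟨hlim, .of_forall fun k => hzK _⟩
  -- Replacing `F(v)` by `v` costs at most `ε (2 R) ^ 2` at `z`, and nothing at `y` because `F(v) ≤
  -- v`.
  have h1 : Filter.Tendsto (fun k => u (z (ψ k)) - v (z (ψ k)) + ε (ψ k) * (2 * R) ^ 2)
      Filter.atTop (𝓝 (u x - v x + 0 * (2 * R) ^ 2)) :=
    (((hu.sub hv) x hx).tendsto.comp hlimK).add
      ((tendsto_one_div_add_atTop_nhds_zero_nat.comp hψ.tendsto_atTop).mul_const _)
  rw [zero_mul, add_zero] at h1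
  refine ge_of_tendsto' h1 fun k => ?_
  have h2 := hzmax (ψ k) y hy
  have h3 := logChange_le (hε0 (ψ k)) (hR' y hy)
  have h4 := sub_le_logChange (hε0 (ψ k)) (hR' _ (hzK (ψ k)))
  have h5 := abs_le.1 (hR _ (hzK (ψ k)))
  have h6 : (v (z (ψ k)) + R) ^ 2 ≤ (2 * R) ^ 2 :=
    pow_le_pow_left₀ (by linarith) (by linarith) 2
  have h7 := mul_le_mul_of_nonneg_left h6 (hε0 (ψ k)).le
  linarith

section Comparison

variable {n m : ℕ} {M : Type*} [TopologicalSpace M] [ChartedSpace (EuclideanSpace ℝ (Fin n)) M]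
  [T2Space M] [IsManifold (𝓡 n) ∞ M]
  {e : OpenPartialHomeomorph M (EuclideanSpace ℝ (Fin n))}
  {X : Fin m → (x : M) → TangentSpace (𝓡 n) x}
  {A : (Fin m → ℝ) → Matrix (Fin m) (Fin m) ℝ} {H : (Fin m → ℝ) → ℝ} {Ω : Set M}

/-- The maxima of `u - F(v)` do not accumulate at a point `x` of `Ω` with nonvanishing horizontal
gradient near which `u` is semiconvex and `v` is semiconcave. -/
lemma not_tendsto_isMax_logChange (hAH : StructureConditions A H)
    (he : e ∈ IsManifold.maximalAtlas (𝓡 n) ∞ M)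
    (hX : ∀ i, ContMDiff (𝓡 n) (𝓡 n).tangent ∞
      (fun x => (⟨x, X i x⟩ : TangentBundle (𝓡 n) M)))
    {u v : M → ℝ} {R C : ℝ} (hΩ : IsOpen Ω) (hC : ∀ y ∈ Ω, u y ≤ C)
    (hR : ∀ y ∈ Ω, -R ≤ v y) (hu : ViscositySub X A H Ω u) (hv : ViscositySuper X A H Ω v)
    {x : M} (hx : x ∈ argmaxOn Ω (fun y => u y - v y)) (hxe : x ∈ e.source)
    (hsu : SemiconvexNear e Ω u x) (hsv : SemiconcaveNear e Ω v x)
    (hgrad : hgrad X u x ≠ 0 ∨ hgrad X v x ≠ 0) {z : ℕ → M} {ε : ℕ → ℝ}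
    (hz : Filter.Tendsto z Filter.atTop (𝓝 x)) (hε : ∀ k, 0 < ε k)
    (hmax : ∀ k, ∀ y ∈ Ω,
      u y + -logChange (ε k) R (v y) ≤ u (z k) + -logChange (ε k) R (v (z k))) : False := by
  obtain ⟨r₁, hr₁, Λ₁, hΛ₁, hb₁, hs₁⟩ := hsu.strongConvexOn
  obtain ⟨r₂, hr₂, Λ₂, hΛ₂, hb₂, hs₂⟩ := SemiconvexNear.strongConvexOn hsv
  set r := min r₁ r₂ with hrdef
  set Λ := max Λ₁ Λ₂ with hΛdef
  have hr : 0 < r := lt_min hr₁ hr₂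
  have hΛ : 0 < Λ := hΛ₁.trans_le (le_max_left _ _)
  set a := e x with ha
  have hax : e.symm a = x := e.left_inv hxe
  have hball : Metric.ball a r ⊆ e.target ∩ e.symm ⁻¹' Ω :=
    (Metric.ball_subset_ball (min_le_left _ _)).trans hb₁
  have hcu := hs₁ r (min_le_left _ _) Λ (le_max_left _ _)
  have hcv := hs₂ r (min_le_right _ _) Λ (le_max_right _ _)
  have hmaxa : ∀ y ∈ Metric.ball a r,
      u (e.symm y) + -v (e.symm y) ≤ u (e.symm a) + -v (e.symm a) := by
    intro y hy
    have : u (e.symm y) - v (e.symm y) ≤ u x - v x := hx.2 (hball hy).2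
    rw [hax]
    linarith
  obtain ⟨p, hpu, hpv⟩ := exists_common_gradient hr hcu hcv hmaxa
  have hupu := contact_upper hpv hmaxa
  have hdu : HasFDerivAt (u ∘ e.symm) (realInner p) a := hasFDerivAt_of_contact hr hpu hupu
  have hdv : HasFDerivAt (v ∘ e.symm) (realInner p) a := by
    have h := (hasFDerivAt_of_contact hr hpv (contact_upper (q := -p) (by rwa [neg_neg])
      fun y hy => by linarith [hmaxa y hy])).neg
    rw [map_neg, neg_neg] at h
    refine h.congr_of_eventuallyEq (.of_forall fun y => ?_)
    simp
  have hatgt : a ∈ e.target := e.map_source hxe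
  set s : Fin m → EuclideanSpace ℝ (Fin n) → EuclideanSpace ℝ (Fin n) :=
    fun i => coordField e (X i) with hs
  have hξ : coordGrad s a (realInner p) ≠ 0 := by
    rcases hgrad with h | h
    · rwa [← hax, hgrad_symm_apply he X hatgt hdu.differentiableAt, hdu.fderiv] at h
    · rwa [← hax, hgrad_symm_apply he X hatgt hdv.differentiableAt, hdv.fderiv] at h
  obtain ⟨δ, hδ, hδξ⟩ := Metric.eventually_nhds_iff.1
    ((continuousAt_coordGrad (q := p) fun i => contDiffAt_coordField he (hX i) hatgt).eventually_ne
      hξ)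
  -- Within distance `t` of `a`, subgradients are within `3 Λ t < δ` of `p`, so the horizontal
  -- gradient stays nonzero; `r / 16` makes the balls below nest.
  set t := min (δ / 2) (min (δ / (6 * Λ)) (r / 16)) with ht
  have ht0 : 0 < t := by positivity
  have ht1 : t < δ := (min_le_left _ _).trans_lt (half_lt_self hδ)
  have ht2 : 3 * Λ * t < δ := by
    have h : t ≤ δ / (6 * Λ) := (min_le_right _ _).trans (min_le_left _ _)
    rw [le_div_iff₀ (by positivity)] at h
    linarith
  have ht3 : t ≤ r / 16 := (min_le_right _ _).trans (min_le_right _ _)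
  obtain ⟨k, hk⟩ := (hz.eventually (((e.continuousAt hxe).eventually
    (Metric.ball_mem_nhds a ht0)).and (e.open_source.mem_nhds hxe))).exists
  set b := e (z k) with hb
  have hbz : e.symm b = z k := e.left_inv hk.2
  have hba : dist b a < t := hk.1
  have hsub : Metric.ball b (r / 2) ⊆ Metric.ball a r := Metric.ball_subset_ball' (by linarith)
  have hsub' : Metric.ball a (r / 4) ⊆ Metric.ball b (r / 2) :=
    Metric.ball_subset_ball' (by rw [dist_comm]; linarith)
  have hcu' : StrongConvexOn (Metric.ball b (r / 2)) (-Λ) (fun y => u (e.symm y)) :=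
    ⟨convex_ball _ _, fun y hy y' hy' => hcu.2 (hsub hy) (hsub hy')⟩
  have hcv' : StrongConvexOn (Metric.ball b (r / 2)) (-Λ)
      (fun y => -logChange (ε k) R (v (e.symm y))) :=
    strongConvexOn_neg_logChange (hε k) hΛ.le (fun y hy => hR _ (hball (hsub hy)).2)
      ⟨convex_ball _ _, fun y hy y' hy' => hcv.2 (hsub hy) (hsub hy')⟩
  have hmaxb : ∀ y ∈ Metric.ball b (r / 2), u (e.symm y) + -logChange (ε k) R (v (e.symm y))
      ≤ u (e.symm b) + -logChange (ε k) R (v (e.symm b)) := by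
    intro y hy
    rw [hbz]
    exact hmax k _ (hball (hsub hy)).2
  obtain ⟨q, hqu, hqv⟩ := exists_common_gradient (half_pos hr) hcu' hcv' hmaxb
  have hqp : ‖q - p‖ ≤ 3 * Λ * t :=
    norm_sub_le_of_contact hΛ (hpu.mono (Metric.ball_subset_ball (by linarith)))
      (fun y hy => hupu y (Metric.ball_subset_ball (by linarith) hy)) ht0
      (by rw [← dist_eq_norm]; exact hba.le) (by linarith : 2 * t < r / 4) (hqu.mono hsub')
  refine hδξ (y := (b, q)) ?_ (not_isMax_of_coordGrad_ne_zero hAH he hX (hε k) hΩ hC hR hu hv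
    (half_pos hr) hΛ (hsub.trans hball) hcu' hcv' hqu hqv hmaxb)
  rw [Prod.dist_eq]
  exact max_lt (hba.trans ht1) (by rw [dist_eq_norm]; exact hqp.trans_lt ht2)

end Comparison

end SubellipticComparison

theorem lemma3p4 {n m : ℕ} {M : Type*} [TopologicalSpace M] [T2Space M]
    [SecondCountableTopology M] [ConnectedSpace M]
    [ChartedSpace (EuclideanSpace ℝ (Fin n)) M] [IsManifold (𝓡 n) ∞ M]
    (X : Fin m → (x : M) → TangentSpace (𝓡 n) x)
    (hX : ∀ i, ContMDiff (𝓡 n) (𝓡 n).tangent ∞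
      (fun x => (⟨x, X i x⟩ : TangentBundle (𝓡 n) M)))
    (A : (Fin m → ℝ) → Matrix (Fin m) (Fin m) ℝ) (H : (Fin m → ℝ) → ℝ)
    (hAH : SubellipticComparison.StructureConditions A H)
    (Ω : Set M) (hΩo : IsOpen Ω) (hΩc : IsConnected Ω) (hΩb : IsCompact (closure Ω))
    (hH : SubellipticComparison.Hormander X Ω)
    (u v : M → ℝ) (hu : ContinuousOn u (closure Ω)) (hv : ContinuousOn v (closure Ω))
    (hbd : ∀ x ∈ frontier Ω, u x ≤ v x)
    (hsub : SubellipticComparison.ViscositySub X A H Ω u)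
    (hsuper : SubellipticComparison.ViscositySuper X A H Ω v)
    (hsemi : ∀ y ∈ SubellipticComparison.argmaxOn Ω (fun x => u x - v x),
      ∃ e ∈ IsManifold.maximalAtlas (𝓡 n) ∞ M, y ∈ e.source ∧
        SubellipticComparison.SemiconvexNear e Ω u y ∧
        SubellipticComparison.SemiconcaveNear e Ω v y)
    (hgrad :
      (∀ y ∈ SubellipticComparison.argmaxOn Ω (fun x => u x - v x),
        SubellipticComparison.hgrad X u y ≠ 0) ∨
      (∀ y ∈ SubellipticComparison.argmaxOn Ω (fun x => u x - v x),
        SubellipticComparison.hgrad X v y ≠ 0)) :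
    ∀ x ∈ Ω, u x ≤ v x := by
  by_contra! hcon
  obtain ⟨x₀, hx₀, hlt⟩ := hcon
  have hne : (closure Ω).Nonempty := hΩc.nonempty.closure
  obtain ⟨R, hR⟩ := hΩb.exists_bound_of_continuousOn hv
  obtain ⟨C, hC⟩ := hΩb.exists_bound_of_continuousOn hu
  obtain ⟨x, hx, hxmax, z, ε, hz, hzε⟩ :=
    SubellipticComparison.exists_tendsto_isMaxOn_logChange hΩb hne hu hv hR
  have hpos : 0 < u x - v x := by
    have : u x₀ - v x₀ ≤ u x - v x := hxmax (subset_closure hx₀)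
    linarith
  have hxΩ : x ∈ Ω := by
    by_contra hxΩ
    have := hbd x ⟨hx, by rwa [hΩo.interior_eq]⟩
    linarith
  have hxarg : x ∈ SubellipticComparison.argmaxOn Ω (fun x => u x - v x) :=
    ⟨hxΩ, hxmax.on_subset subset_closure⟩
  obtain ⟨e, he, hxe, hsu, hsv⟩ := hsemi x hxarg
  exact SubellipticComparison.not_tendsto_isMax_logChange hAH he hX hΩo
    (fun y hy => (abs_le.1 (hC y (subset_closure hy))).2)
    (fun y hy => (abs_le.1 (hR y (subset_closure hy))).1) hsub hsuper hxarg hxe hsu hsv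
    (hgrad.imp (fun h => h x hxarg) fun h => h x hxarg) hz (fun k => (hzε k).1)
    (fun k y hy => (hzε k).2.2 y (subset_closure hy))
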